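/- Let $\mathbb{K}$ be a commutative ring and let $A = \bigoplus_{i \in \mathbb{Z}} A^i$ be a DG $\mathbb{K}$-algebra (associative and unital, not necessarily commutative). For left DG $A$-modules $M, N$ let $\operatorname{Hom}_A(M,N) = \bigoplus_{i\in\mathbb{Z}} \operatorname{Hom}^i_A(M,N)$ be the DG $\mathbb{K}$-module whose degree $i$ part consists of the $\mathbb{K}$-linear maps $f : M \to N$ of degree $i$ with $f(am) = (-1)^{ij} a f(m)$ for $a \in A^j$, $m \in M$, with differential $f \mapsto d_N \circ f - (-1)^i f \circ d_M$ on $\operatorname{Hom}^i_A(M,N)$; and let $\operatorname{End}_A(M) := \operatorname{Hom}_A(M,M)$, a DG $\mathbb{K}$-algebra under composition, over which $M$ is a left DG module by evaluation. A DG $A$-module $P$ is K-projective if $\operatorname{Hom}_A(P,N)$ is acyclic for every acyclic DG $A$-module $N$; a K-projective resolution of $M$ is a quasi-isomorphism $P \to M$ of DG $A$-modules with $P$ K-projective. Proposition. Let $M$ be a left DG $A$-module, and let $P \to M$ and $P' \to M$ be K-projective resolutions. Put $B := \operatorname{End}_A(P)$ and $B' := \operatorname{End}_A(P')$. Then there exist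 a DG $\mathbb{K}$-algebra $B''$, a left DG $B''$-module $P''$, DG $\mathbb{K}$-algebra quasi-isomorphisms $B'' \to B$ and $B'' \to B'$, and DG $B''$-module quasi-isomorphisms $P'' \to P$ and $P'' \to P'$, where $P$ and $P'$ are regarded as DG $B''$-modules by restriction along $B'' \to B$ and $B'' \to B'$ respectively. -/

import Mathlib

open scoped DirectSum

universe u v w w'

/-! DG modules over a commutative ring `K`, their cohomology and quasi-isomorphisms. -/

/-- A DG `K`-module `X = ⨁ Xⁱ` (a cochain complex of `K`-modules), with its grading given by
submodules of the total space and a differential of degree `1`. -/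
structure DGComplex (K : Type u) [CommRing K] where
  carrier : Type w
  [addCommGroup : AddCommGroup carrier]
  [module : Module K carrier]
  grading : ℤ → Submodule K carrier
  isInternal : DirectSum.IsInternal grading
  d : carrier →ₗ[K] carrier
  d_mem : ∀ (i : ℤ) (x : carrier), x ∈ grading i → d x ∈ grading (i + 1)
  d_d : ∀ x : carrier, d (d x) = 0

namespace DGComplex

attribute [instance] DGComplex.addCommGroup DGComplex.module

variable {K : Type u} [CommRing K]

/-- A homomorphism of DG `K`-modules: linear of degree `0`, commuting with the differentials. -/
structure Hom (X : DGComplex.{u, w} K) (Y : DGComplex.{u, w'} K) extends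
    X.carrier →ₗ[K] Y.carrier where
  map_mem : ∀ (i : ℤ) (x : X.carrier), x ∈ X.grading i → toLinearMap x ∈ Y.grading i
  map_d : ∀ x : X.carrier, toLinearMap (X.d x) = Y.d (toLinearMap x)

/-- The cocycles. -/
def cocycles (X : DGComplex.{u, w} K) : Submodule K X.carrier := LinearMap.ker X.d

/-- The coboundaries, as a submodule of the cocycles. -/
def coboundaries (X : DGComplex.{u, w} K) : Submodule K X.cocycles :=
  (LinearMap.range X.d).submoduleOf X.cocycles

/-- The total cohomology `H(X) = ⨁ Hⁱ(X)`, that is, cocycles modulo coboundaries. -/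
abbrev cohomology (X : DGComplex.{u, w} K) : Type w := X.cocycles ⧸ X.coboundaries

/-- The map on cocycles induced by a homomorphism. -/
def Hom.cocyclesMap {X : DGComplex.{u, w} K} {Y : DGComplex.{u, w'} K} (f : Hom X Y) :
    X.cocycles →ₗ[K] Y.cocycles :=
  f.toLinearMap.restrict (fun x hx => by
    change Y.d (f.toLinearMap x) = 0
    rw [← f.map_d, show X.d x = 0 from hx, map_zero])

/-- The map `H(f) : H(X) → H(Y)` induced by a homomorphism. -/
def Hom.cohomologyMap {X : DGComplex.{u, w} K} {Y : DGComplex.{u, w'} K} (f : Hom X Y) :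
    X.cohomology →ₗ[K] Y.cohomology :=
  Submodule.mapQ X.coboundaries Y.coboundaries f.cocyclesMap (by
    rintro ⟨x, hx⟩ ⟨y, hy⟩
    exact ⟨f.toLinearMap y, by rw [← f.map_d, hy]; rfl⟩)

/-- A quasi-isomorphism: a homomorphism inducing an isomorphism on cohomology. -/
def Hom.IsQuasiIso {X : DGComplex.{u, w} K} {Y : DGComplex.{u, w'} K} (f : Hom X Y) : Prop :=
  Function.Bijective f.cohomologyMap

/-- An acyclic DG module: its cohomology vanishes. -/
def IsAcyclic (X : DGComplex.{u, w} K) : Prop := Subsingleton X.cohomology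

/-- The linear automorphism `x ↦ (-1)ⁱ x` for `x` of degree `i`. -/
noncomputable def sign (X : DGComplex.{u, w} K) : X.carrier →ₗ[K] X.carrier :=
  (DirectSum.toModule K ℤ X.carrier (fun i => i.negOnePow • (X.grading i).subtype)) ∘ₗ
    (LinearEquiv.ofBijective (DirectSum.coeLinearMap X.grading) X.isInternal).symm.toLinearMap

theorem sign_of_mem (X : DGComplex.{u, w} K) {i : ℤ} {x : X.carrier} (hx : x ∈ X.grading i) :
    X.sign x = i.negOnePow • x := by
  have h : (LinearEquiv.ofBijective (DirectSum.coeLinearMap X.grading) X.isInternal).symm x =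
      DirectSum.lof K ℤ (fun i => X.grading i) i ⟨x, hx⟩ := by
    rw [LinearEquiv.symm_apply_eq]
    exact (DirectSum.coeLinearMap_lof X.grading i ⟨x, hx⟩).symm
  simp only [sign, LinearMap.comp_apply, LinearEquiv.coe_coe, h, DirectSum.toModule_lof]
  rfl

/-- Induction on homogeneous elements. -/
theorem induction (X : DGComplex.{u, w} K) {p : X.carrier → Prop}
    (mem : ∀ (i : ℤ) (x : X.carrier), x ∈ X.grading i → p x) (zero : p 0)
    (add : ∀ x y, p x → p y → p (x + y)) (x : X.carrier) : p x := by
  have hx : x ∈ ⨆ i, X.grading i := by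
    rw [X.isInternal.submodule_iSup_eq_top]; trivial
  exact Submodule.iSup_induction X.grading (motive := p) hx mem zero add

theorem sign_sign (X : DGComplex.{u, w} K) (x : X.carrier) : X.sign (X.sign x) = x := by
  refine X.induction (p := fun x => X.sign (X.sign x) = x) (fun i x hx => ?_) (by simp)
    (fun x y hx hy => by rw [map_add, map_add, hx, hy]) x
  rcases Int.units_eq_one_or i.negOnePow with h | h <;>
  simp [X.sign_of_mem hx, h, Units.neg_smul]

end DGComplex

/-! DG algebras. -/

/-- A DG `K`-algebra `A = ⨁ Aⁱ` (associative and unital, not necessarily commutative). -/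
structure DGAlgebra (K : Type u) [CommRing K] where
  carrier : Type v
  [ring : Ring carrier]
  [algebra : Algebra K carrier]
  grading : ℤ → Submodule K carrier
  [gradedMonoid : SetLike.GradedMonoid grading]
  isInternal : DirectSum.IsInternal grading
  d : carrier →ₗ[K] carrier
  d_mem : ∀ (i : ℤ) (a : carrier), a ∈ grading i → d a ∈ grading (i + 1)
  d_d : ∀ a : carrier, d (d a) = 0
  d_mul : ∀ (i : ℤ) (a b : carrier), a ∈ grading i →
    d (a * b) = d a * b + i.negOnePow • (a * d b)

namespace DGAlgebra

attribute [instance] DGAlgebra.ring DGAlgebra.algebra DGAlgebra.gradedMonoid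

variable {K : Type u} [CommRing K]

/-- The underlying DG `K`-module of a DG algebra. -/
def toDGComplex (A : DGAlgebra.{u, v} K) : DGComplex.{u, v} K where
  carrier := A.carrier
  grading := A.grading
  isInternal := A.isInternal
  d := A.d
  d_mem := A.d_mem
  d_d := A.d_d

/-- A homomorphism of DG `K`-algebras: a unital `K`-algebra homomorphism of degree `0`,
commuting with the differentials. -/
structure Hom (A : DGAlgebra.{u, v} K) (B : DGAlgebra.{u, w} K) extends
    A.carrier →ₐ[K] B.carrier where
  map_mem : ∀ (i : ℤ) (a : A.carrier), a ∈ A.grading i → toAlgHom a ∈ B.grading i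
  map_d : ∀ a : A.carrier, toAlgHom (A.d a) = B.d (toAlgHom a)

/-- The underlying homomorphism of DG `K`-modules. -/
def Hom.toDGComplexHom {A : DGAlgebra.{u, v} K} {B : DGAlgebra.{u, w} K} (f : Hom A B) :
    DGComplex.Hom A.toDGComplex B.toDGComplex where
  toLinearMap := f.toAlgHom.toLinearMap
  map_mem := f.map_mem
  map_d := f.map_d

/-- A DG algebra quasi-isomorphism. -/
def Hom.IsQuasiIso {A : DGAlgebra.{u, v} K} {B : DGAlgebra.{u, w} K} (f : Hom A B) : Prop :=
  f.toDGComplexHom.IsQuasiIso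

end DGAlgebra

/-! DG modules over a DG algebra. -/

/-- A left DG module `M = ⨁ Mⁱ` over the DG `K`-algebra `A`. -/
structure DGModule {K : Type u} [CommRing K] (A : DGAlgebra.{u, v} K) extends
    DGComplex.{u, w} K where
  [moduleA : Module A.carrier carrier]
  [isScalarTower : IsScalarTower K A.carrier carrier]
  smul_mem : ∀ (i j : ℤ) (a : A.carrier) (m : carrier),
    a ∈ A.grading i → m ∈ grading j → a • m ∈ grading (i + j)
  d_smul : ∀ (i : ℤ) (a : A.carrier) (m : carrier), a ∈ A.grading i →
    d (a • m) = A.d a • m + i.negOnePow • (a • d m)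

namespace DGModule

attribute [instance] DGModule.moduleA DGModule.isScalarTower

variable {K : Type u} [CommRing K] {A : DGAlgebra.{u, v} K}

/-- A homomorphism of DG `A`-modules: `A`-linear of degree `0`, commuting with the
differentials. -/
structure Hom (M : DGModule.{u, v, w} A) (N : DGModule.{u, v, w'} A) extends
    M.carrier →ₗ[A.carrier] N.carrier where
  map_mem : ∀ (i : ℤ) (m : M.carrier), m ∈ M.grading i → toLinearMap m ∈ N.grading i
  map_d : ∀ m : M.carrier, toLinearMap (M.d m) = N.d (toLinearMap m)

/-- The underlying homomorphism of DG `K`-modules. -/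
def Hom.toDGComplexHom {M : DGModule.{u, v, w} A} {N : DGModule.{u, v, w'} A} (f : Hom M N) :
    DGComplex.Hom M.toDGComplex N.toDGComplex where
  toLinearMap := f.toLinearMap.restrictScalars K
  map_mem := f.map_mem
  map_d := f.map_d

/-- A DG module quasi-isomorphism. -/
def Hom.IsQuasiIso {M : DGModule.{u, v, w} A} {N : DGModule.{u, v, w'} A} (f : Hom M N) : Prop :=
  f.toDGComplexHom.IsQuasiIso

/-- Restriction of scalars along a homomorphism `f : A → B` of DG algebras: the same DG `K`-module
with `a • n = f a • n`. -/
@[reducible] def restrict {B : DGAlgebra.{u, w'} K} (f : DGAlgebra.Hom A B)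
    (N : DGModule.{u, w', w} B) : DGModule.{u, v, w} A :=
  letI : Module A.carrier N.carrier := Module.compHom N.carrier f.toAlgHom.toRingHom
  { toDGComplex := N.toDGComplex
    isScalarTower := ⟨fun k a n => by
      change f.toAlgHom (k • a) • n = k • (f.toAlgHom a • n)
      rw [map_smul, smul_assoc]⟩
    smul_mem := fun i j a n ha hn => N.smul_mem i j _ n (f.map_mem i a ha) hn
    d_smul := fun i a n ha => by
      change N.d (f.toAlgHom a • n) = f.toAlgHom (A.d a) • n + i.negOnePow • (f.toAlgHom a • N.d n)
      rw [f.map_d]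
      exact N.d_smul i _ n (f.map_mem i a ha) }

/-- `Homⁱ_A(M, N)`: the `A`-linear homomorphisms of degree `i`, where linearity of a homomorphism
of degree `i` means `f (a m) = (-1) ^ (i j) a f(m)` for `a` of degree `j`. -/
def homDeg (M : DGModule.{u, v, w} A) (N : DGModule.{u, v, w'} A) (i : ℤ) :
    Submodule K (M.carrier →ₗ[K] N.carrier) where
  carrier := {f | (∀ (j : ℤ) (m : M.carrier), m ∈ M.grading j → f m ∈ N.grading (i + j)) ∧
    ∀ (j : ℤ) (a : A.carrier) (m : M.carrier), a ∈ A.grading j →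
      f (a • m) = (i * j).negOnePow • (a • f m)}
  add_mem' := by
    rintro f g ⟨hf, hf'⟩ ⟨hg, hg'⟩
    refine ⟨fun j m hm => add_mem (hf j m hm) (hg j m hm), fun j a m ha => ?_⟩
    simp only [LinearMap.add_apply, hf' j a m ha, hg' j a m ha, smul_add]
  zero_mem' := ⟨fun j m _ => zero_mem _, fun j a m _ => by simp⟩
  smul_mem' := by
    rintro k f ⟨hf, hf'⟩
    refine ⟨fun j m hm => Submodule.smul_mem _ k (hf j m hm), fun j a m ha => ?_⟩
    rw [LinearMap.smul_apply, LinearMap.smul_apply, hf' j a m ha, smul_comm k, smul_algebra_smul_comm]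

/-- The underlying `K`-module of `Hom_A(M, N)`: the sum (which is direct, by `homDeg_iSupIndep`)
of the `Homⁱ_A(M, N)` over all integers `i`, taken inside the `K`-linear maps. -/
def homTotal (M : DGModule.{u, v, w} A) (N : DGModule.{u, v, w'} A) :
    Submodule K (M.carrier →ₗ[K] N.carrier) :=
  ⨆ i, homDeg M N i

theorem homDeg_iSupIndep (M : DGModule.{u, v, w} A) (N : DGModule.{u, v, w'} A) :
    iSupIndep (homDeg M N) := by
  rw [iSupIndep_iff_finsetSum_eq_zero_imp_eq_zero]
  intro s f hf h0 i hi
  ext m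
  refine M.toDGComplex.induction (p := fun m => f i m = 0) (fun j m hm => ?_) (map_zero _)
    (fun x y hx hy => ?_) m
  · have hN := N.isInternal.submodule_iSupIndep.comp (f := fun i : ℤ => i + j)
      (add_left_injective j)
    rw [iSupIndep_iff_finsetSum_eq_zero_imp_eq_zero] at hN
    refine hN s (fun i => f i m) (fun i hi => (hf i hi).1 j m hm) ?_ i hi
    rw [← LinearMap.sum_apply, h0, LinearMap.zero_apply]
  · rw [map_add, hx, hy, add_zero]

/-- The pieces of an independent family of submodules form an internal grading of their sum. -/
theorem isInternal_comap {V : Type w} [AddCommGroup V] [Module K V]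
    (G : ℤ → Submodule K V) (hG : iSupIndep G) (S : Submodule K V) (hS : S = ⨆ i, G i) :
    DirectSum.IsInternal (fun i => (G i).comap S.subtype) := by
  refine (DirectSum.isInternal_submodule_iff_iSupIndep_and_iSup_eq_top _).2 ⟨?_, ?_⟩
  · rw [iSupIndep_iff_finsetSum_eq_zero_imp_eq_zero] at hG ⊢
    intro s x hx h0 i hi
    refine Subtype.ext (hG s (fun i => (x i : V)) hx ?_ i hi)
    rw [← Submodule.coe_sum, h0, Submodule.coe_zero]
  · apply Submodule.map_injective_of_injective S.injective_subtype
    rw [Submodule.map_iSup, Submodule.map_subtype_top]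
    conv_rhs => rw [hS]
    refine iSup_congr fun i => ?_
    rw [Submodule.map_comap_subtype, inf_eq_right, hS]
    exact le_iSup G i

/-- The differential `f ↦ d_N ∘ f - (-1)ⁱ f ∘ d_M` (for `f` of degree `i`; see `homD_of_mem`),
written for all `f` at once: `sign ∘ f ∘ sign` equals `(-1)ⁱ f` when `f` has degree `i`. -/
noncomputable def homD (M : DGModule.{u, v, w} A) (N : DGModule.{u, v, w'} A) :
    (M.carrier →ₗ[K] N.carrier) →ₗ[K] (M.carrier →ₗ[K] N.carrier) :=
  LinearMap.llcomp K M.carrier N.carrier N.carrier N.d -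
    LinearMap.llcomp K M.carrier N.carrier N.carrier N.sign ∘ₗ
      LinearMap.lcomp K N.carrier (M.sign ∘ₗ M.d)

theorem homD_apply (M : DGModule.{u, v, w} A) (N : DGModule.{u, v, w'} A)
    (f : M.carrier →ₗ[K] N.carrier) (m : M.carrier) :
    homD M N f m = N.d (f m) - N.sign (f (M.sign (M.d m))) := rfl

theorem sign_conj (M : DGModule.{u, v, w} A) (N : DGModule.{u, v, w'} A) {i : ℤ}
    {f : M.carrier →ₗ[K] N.carrier} (hf : f ∈ homDeg M N i) (m : M.carrier) :
    N.sign (f (M.sign m)) = i.negOnePow • f m := by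
  refine M.toDGComplex.induction (p := fun m => N.sign (f (M.sign m)) = i.negOnePow • f m)
    (fun j m hm => ?_) (by simp) (fun x y hx hy => ?_) m
  · rw [M.sign_of_mem hm, N.sign_of_mem (i := i + j), Int.negOnePow_add]
    · rcases Int.units_eq_one_or j.negOnePow with h | h <;>
      rcases Int.units_eq_one_or i.negOnePow with h' | h' <;> simp [h, h', Units.neg_smul]
    · rcases Int.units_eq_one_or j.negOnePow with h | h <;> simp [h, Units.neg_smul, hf.1 j m hm]
  · simp only [map_add, smul_add, hx, hy]

theorem homD_of_mem (M : DGModule.{u, v, w} A) (N : DGModule.{u, v, w'} A) {i : ℤ}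
    {f : M.carrier →ₗ[K] N.carrier} (hf : f ∈ homDeg M N i) (m : M.carrier) :
    homD M N f m = N.d (f m) - i.negOnePow • f (M.d m) := by
  rw [homD_apply, sign_conj M N hf]

theorem homD_mem (M : DGModule.{u, v, w} A) (N : DGModule.{u, v, w'} A) {i : ℤ}
    {f : M.carrier →ₗ[K] N.carrier} (hf : f ∈ homDeg M N i) :
    homD M N f ∈ homDeg M N (i + 1) := by
  refine ⟨fun j m hm => ?_, fun j a m ha => ?_⟩
  · rw [homD_of_mem M N hf]
    have h1 := N.d_mem _ _ (hf.1 j m hm)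
    have h2 := hf.1 _ _ (M.d_mem _ _ hm)
    rw [show i + j + 1 = i + 1 + j by ring] at h1
    rw [show i + (j + 1) = i + 1 + j by ring] at h2
    rcases Int.units_eq_one_or i.negOnePow with h | h <;> rw [h]
    · rw [one_smul]; exact sub_mem h1 h2
    · rw [Units.neg_smul, one_smul]; exact sub_mem h1 (neg_mem h2)
  · have hd := A.d_mem _ _ ha
    rw [homD_of_mem M N hf, homD_of_mem M N hf, hf.2 j a m ha, M.d_smul j a m ha, map_add,
      hf.2 _ _ m hd, show i * (j + 1) = i * j + i by ring, show (i + 1) * j = i * j + j by ring,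
      Int.negOnePow_add, Int.negOnePow_add]
    have e := hf.2 j a (M.d m) ha
    have e' := N.d_smul j a (f m) ha
    rcases Int.units_eq_one_or i.negOnePow with h | h <;>
    rcases Int.units_eq_one_or j.negOnePow with h' | h' <;>
    rcases Int.units_eq_one_or (i * j).negOnePow with h'' | h'' <;>
    simp only [h, h', h'', one_smul, Units.neg_smul, map_neg, mul_one, mul_neg, neg_neg,
      smul_sub, smul_neg, smul_add] at e e' ⊢ <;> rw [e, e'] <;> abel

theorem homD_mem_homTotal (M : DGModule.{u, v, w} A) (N : DGModule.{u, v, w'} A)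
    (f : M.carrier →ₗ[K] N.carrier) (hf : f ∈ homTotal M N) : homD M N f ∈ homTotal M N := by
  refine Submodule.iSup_induction (homDeg M N) (motive := fun f => homD M N f ∈ homTotal M N) hf
    (fun i f hf => ?_) ?_ (fun f g hf hg => ?_)
  · exact Submodule.mem_iSup_of_mem (i + 1) (homD_mem M N hf)
  · rw [map_zero]; exact zero_mem _
  · rw [map_add]; exact add_mem hf hg

theorem homD_homD (M : DGModule.{u, v, w} A) (N : DGModule.{u, v, w'} A)
    (f : M.carrier →ₗ[K] N.carrier) (hf : f ∈ homTotal M N) : homD M N (homD M N f) = 0 := by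
  refine Submodule.iSup_induction (homDeg M N) (motive := fun f => homD M N (homD M N f) = 0) hf
    (fun i f hf => ?_) (by simp) (fun f g hf hg => by rw [map_add, map_add, hf, hg, add_zero])
  ext m
  rw [homD_of_mem M N (homD_mem M N hf), homD_of_mem M N hf, homD_of_mem M N hf, M.d_d, map_sub,
    N.d_d, Int.negOnePow_succ]
  rcases Int.units_eq_one_or i.negOnePow with h | h <;> simp [h, Units.neg_smul]

/-- The DG `K`-module `Hom_A(M, N) = ⨁ Homⁱ_A(M, N)`. -/
noncomputable def homComplex (M : DGModule.{u, v, w} A) (N : DGModule.{u, v, w'} A) :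
    DGComplex.{u, max w w'} K where
  carrier := homTotal M N
  grading i := (homDeg M N i).comap (homTotal M N).subtype
  isInternal := isInternal_comap (homDeg M N) (homDeg_iSupIndep M N) (homTotal M N) rfl
  d := (homD M N).restrict (homD_mem_homTotal M N)
  d_mem _ _ hf := homD_mem M N hf
  d_d f := Subtype.ext (homD_homD M N f.1 f.2)

theorem one_mem_homDeg (M : DGModule.{u, v, w} A) :
    (1 : Module.End K M.carrier) ∈ homDeg M M 0 :=
  ⟨fun j m hm => by simpa using hm, fun j a m _ => by simp⟩

theorem mul_mem_homDeg (M : DGModule.{u, v, w} A) {i j : ℤ} {f g : Module.End K M.carrier}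
    (hf : f ∈ homDeg M M i) (hg : g ∈ homDeg M M j) : f * g ∈ homDeg M M (i + j) := by
  refine ⟨fun l m hm => ?_, fun l a m ha => ?_⟩
  · rw [add_assoc]
    exact hf.1 _ _ (hg.1 l m hm)
  · have e := hf.2 l a (g m) ha
    rw [Module.End.mul_apply, Module.End.mul_apply, hg.2 l a m ha, add_mul, Int.negOnePow_add]
    rcases Int.units_eq_one_or (i * l).negOnePow with h | h <;>
    rcases Int.units_eq_one_or (j * l).negOnePow with h' | h' <;>
    simp only [h, h', Units.neg_smul, one_smul, map_neg, mul_one, mul_neg, neg_neg] at e ⊢ <;>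
    simp only [e, neg_neg]

theorem homD_comp (M : DGModule.{u, v, w} A) {i : ℤ} {f : M.carrier →ₗ[K] M.carrier}
    (hf : f ∈ homDeg M M i) (g : M.carrier →ₗ[K] M.carrier) :
    homD M M (f ∘ₗ g) = homD M M f ∘ₗ g + i.negOnePow • (f ∘ₗ homD M M g) := by
  ext m
  have e := sign_conj M M hf (M.sign (g (M.sign (M.d m))))
  rw [M.sign_sign] at e
  have h2 : homD M M g m = M.d (g m) - M.sign (g (M.sign (M.d m))) := rfl
  change homD M M (f ∘ₗ g) m = homD M M f (g m) + i.negOnePow • f (homD M M g m)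
  rw [homD_of_mem M M hf, h2, homD_apply, LinearMap.comp_apply, LinearMap.comp_apply, e,
    map_sub f, smul_sub]
  abel

/-- The underlying `K`-algebra of `End_A(M)`: same elements as `homTotal M M`, multiplied by
composition. -/
def endSubalgebra (M : DGModule.{u, v, w} A) : Subalgebra K (Module.End K M.carrier) :=
  (homTotal M M).toSubalgebra (Submodule.mem_iSup_of_mem 0 (one_mem_homDeg M)) (by
    intro f g hf hg
    refine Submodule.iSup_induction (homDeg M M) (motive := fun f => f * g ∈ homTotal M M) hf
      (fun i f hf => ?_) ?_ (fun f f' hf hf' => ?_)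
    · refine Submodule.iSup_induction (homDeg M M) (motive := fun g => f * g ∈ homTotal M M) hg
        (fun j g hg => ?_) ?_ (fun g g' hg hg' => ?_)
      · exact Submodule.mem_iSup_of_mem (i + j) (mul_mem_homDeg M hf hg)
      · rw [mul_zero]; exact zero_mem _
      · rw [mul_add]; exact add_mem hg hg'
    · rw [zero_mul]; exact zero_mem _
    · rw [add_mul]; exact add_mem hf hf')

/-- The DG `K`-algebra `End_A(M) = Hom_A(M, M)`, with composition as multiplication. -/
noncomputable def endAlgebra (M : DGModule.{u, v, w} A) : DGAlgebra.{u, w} K where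
  carrier := endSubalgebra M
  grading i := (homDeg M M i).comap (endSubalgebra M).val.toLinearMap
  gradedMonoid :=
    { one_mem := one_mem_homDeg M
      mul_mem := fun _ _ _ _ hf hg => mul_mem_homDeg M hf hg }
  isInternal := (homComplex M M).isInternal
  d := (homComplex M M).d
  d_mem := (homComplex M M).d_mem
  d_d := (homComplex M M).d_d
  d_mul _ _ g hf := Subtype.ext (homD_comp M hf g.1)

/-- The DG `K`-module `M` as a left DG module over `End_A(M)`, acting by evaluation. -/
noncomputable def overEnd (M : DGModule.{u, v, w} A) : DGModule.{u, w, w} (endAlgebra M) where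
  toDGComplex := M.toDGComplex
  moduleA := inferInstanceAs (Module (endSubalgebra M) M.carrier)
  isScalarTower := inferInstanceAs (IsScalarTower K (endSubalgebra M) M.carrier)
  smul_mem i j f m hf hm := hf.1 j m hm
  d_smul i f m hf := by
    have e := homD_of_mem M M hf m
    change M.d (f.1 m) = homD M M f.1 m + i.negOnePow • f.1 (M.d m)
    exact (congrArg (fun x => x + i.negOnePow • f.1 (M.d m)) e |>.trans (sub_add_cancel _ _)).symm

/-- A DG `A`-module `P` is K-projective if `Hom_A(P, N)` is acyclic for every acyclic
DG `A`-module `N`. -/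
def IsKProjective (P : DGModule.{u, v, w} A) : Prop :=
  ∀ N : DGModule.{u, v, w} A, N.toDGComplex.IsAcyclic → (homComplex P N).IsAcyclic

end DGModule

/-! K-projectivity lets `p` be lifted through the quasi-isomorphism `p'` up to homotopy, which gives
a quasi-isomorphism `φ : P → P'` (`IsKProjective.exists_isQuasiIso`). Composition with `φ` gives
maps `End_A(P) → Hom_A(P, P') ← End_A(P')`. Both are quasi-isomorphisms: the first because `Hom_A(P,
-)` preserves quasi-isomorphisms (`IsKProjective.homPost_isQuasiIso`), the second because `φ` is a
homotopy equivalence (`IsKProjective.homPre_isQuasiIso`). Hence both projections from the homotopy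
pullback of this diagram are quasi-isomorphisms.

The homotopy pullback consists of triples `(b, b', h)`, and it has to be made a DG algebra. A triple
is read as a lower triangular endomorphism of `P ⊕ P' ⊕ P'[-1]`, with diagonal `b, b', ±b'` and with
`h` going from `P` to `P'[-1]`. The complex `P ⊕ P' ⊕ P'[-1]` is itself the homotopy pullback of `φ`
and the identity of `P'`, and the commutator with its differential restricts to the differential of
the triples (`homD_pathEnd`). So the triples form a DG algebra `B''` acting on `P'' = P ⊕ P' ⊕
P'[-1]`. The projections of `P''` to `P` and `P'` are quasi-isomorphisms because the identity and
`φ` are. -/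

namespace DGComplex

variable {K : Type u} [CommRing K]

/-! ### Cocycle criteria and homogeneous components. -/

/-- A homomorphism is a quasi-isomorphism as soon as every cocycle of the target is cohomologous
to the image of a cocycle, and every cocycle whose image is a coboundary is a coboundary. -/
theorem Hom.isQuasiIso_iff {X : DGComplex.{u, w} K} {Y : DGComplex.{u, w'} K} (f : Hom X Y) :
    f.IsQuasiIso ↔
      (∀ x, X.d x = 0 → (∃ y, f.toLinearMap x = Y.d y) → ∃ x', x = X.d x') ∧
      (∀ y, Y.d y = 0 → ∃ x, X.d x = 0 ∧ ∃ z, f.toLinearMap x - y = Y.d z) := by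
  refine and_congr ?_ ?_
  · rw [injective_iff_map_eq_zero]
    constructor
    · rintro H x hx ⟨y, hy⟩
      have h := H (Submodule.Quotient.mk ⟨x, hx⟩)
        ((Submodule.Quotient.mk_eq_zero Y.coboundaries).2 ⟨y, hy.symm⟩)
      obtain ⟨x', hx'⟩ := (Submodule.Quotient.mk_eq_zero X.coboundaries).1 h
      exact ⟨x', hx'.symm⟩
    · intro H a ha
      obtain ⟨⟨x, hx⟩, rfl⟩ := Submodule.Quotient.mk_surjective _ a
      obtain ⟨y, hy⟩ := (Submodule.Quotient.mk_eq_zero Y.coboundaries).1 ha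
      obtain ⟨x', hx'⟩ := H x hx ⟨y, hy.symm⟩
      exact (Submodule.Quotient.mk_eq_zero X.coboundaries).2 ⟨x', hx'.symm⟩
  · constructor
    · intro H y hy
      obtain ⟨a, ha⟩ := H (Submodule.Quotient.mk ⟨y, hy⟩)
      obtain ⟨⟨x, hx⟩, rfl⟩ := Submodule.Quotient.mk_surjective _ a
      obtain ⟨z, hz⟩ := (Submodule.Quotient.eq Y.coboundaries).1 ha
      exact ⟨x, hx, z, hz.symm⟩
    · intro H a
      obtain ⟨⟨y, hy⟩, rfl⟩ := Submodule.Quotient.mk_surjective _ a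
      obtain ⟨x, hx, z, hz⟩ := H y hy
      exact ⟨Submodule.Quotient.mk ⟨x, hx⟩,
        (Submodule.Quotient.eq Y.coboundaries).2 ⟨z, hz.symm⟩⟩

theorem isAcyclic_iff (X : DGComplex.{u, w} K) :
    X.IsAcyclic ↔ ∀ x, X.d x = 0 → ∃ y, x = X.d y := by
  constructor
  · intro H x hx
    obtain ⟨y, hy⟩ := (Submodule.Quotient.mk_eq_zero X.coboundaries).1
      (@Subsingleton.elim _ H (Submodule.Quotient.mk ⟨x, hx⟩) 0)
    exact ⟨y, hy.symm⟩
  · intro H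
    refine subsingleton_of_forall_eq 0 fun a => ?_
    obtain ⟨⟨x, hx⟩, rfl⟩ := Submodule.Quotient.mk_surjective _ a
    obtain ⟨y, hy⟩ := H x hx
    exact (Submodule.Quotient.mk_eq_zero X.coboundaries).2 ⟨y, hy.symm⟩

/-- The projection of a DG module onto its part of degree `i`. -/
theorem exists_proj (X : DGComplex.{u, w} K) : ∃ π : ℤ → X.carrier →ₗ[K] X.carrier,
    (∀ i x, π i x ∈ X.grading i) ∧ (∀ i x, x ∈ X.grading i → π i x = x) ∧
      ∀ i j x, x ∈ X.grading i → i ≠ j → π j x = 0 := by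
  have key : ∀ i x (hx : x ∈ X.grading i),
      (LinearEquiv.ofBijective (DirectSum.coeLinearMap X.grading) X.isInternal).symm x =
      DirectSum.lof K ℤ (fun i => X.grading i) i ⟨x, hx⟩ := fun i x hx => by
    rw [LinearEquiv.symm_apply_eq]
    exact (DirectSum.coeLinearMap_lof X.grading i ⟨x, hx⟩).symm
  refine ⟨fun i => (X.grading i).subtype ∘ₗ DirectSum.component K ℤ (fun i => X.grading i) i ∘ₗ
    (LinearEquiv.ofBijective (DirectSum.coeLinearMap X.grading) X.isInternal).symm.toLinearMap,
    fun i _ => Submodule.coe_mem _, fun i x hx => ?_, fun i j x hx hij => ?_⟩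
  · simp only [LinearMap.comp_apply, LinearEquiv.coe_coe, key i x hx, DirectSum.component.lof_self]
    rfl
  · simp only [LinearMap.comp_apply, LinearEquiv.coe_coe, key i x hx, DirectSum.component.of,
      dif_neg hij, map_zero]

/-- A homogeneous coboundary is the coboundary of a homogeneous element. -/
theorem exists_mem_grading_of_eq_d (X : DGComplex.{u, w} K) {i : ℤ} {y : X.carrier}
    (h : X.d y ∈ X.grading (i + 1)) : ∃ y' ∈ X.grading i, X.d y = X.d y' := by
  obtain ⟨π, h1, h2, h3⟩ := X.exists_proj
  refine ⟨π i y, h1 i y, ?_⟩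
  rw [← h2 _ _ h]
  clear h
  -- The projections commute with the differential up to the degree shift, so `y` may be replaced by
  -- its component of degree `i`.
  refine X.induction (p := fun y => π (i + 1) (X.d y) = X.d (π i y)) (fun j x hx => ?_)
    (by simp) (fun x y hx hy => by simp only [map_add, hx, hy]) y
  by_cases hij : j = i
  · subst hij
    rw [h2 _ _ hx, h2 _ _ (X.d_mem _ _ hx)]
  · rw [h3 _ _ _ hx hij, map_zero, h3 _ _ _ (X.d_mem _ _ hx) (by simpa using hij)]

theorem sign_d (X : DGComplex.{u, w} K) (x : X.carrier) : X.sign (X.d x) = - X.d (X.sign x) := by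
  refine X.induction (p := fun x => X.sign (X.d x) = - X.d (X.sign x)) (fun i x hx => ?_)
    (by simp) (fun x y hx hy => by simp only [map_add, hx, hy, neg_add]) x
  rw [X.sign_of_mem hx, X.sign_of_mem (X.d_mem _ _ hx), Int.negOnePow_succ]
  rcases Int.units_eq_one_or i.negOnePow with h | h <;> simp [h, Units.neg_smul]

/-! ### Direct sums, cocones and homotopy pullbacks of DG `K`-modules. -/

theorem _root_.DirectSum.IsInternal.prod_submodule {V W : Type*} [AddCommGroup V] [AddCommGroup W]
    [Module K V] [Module K W] {G : ℤ → Submodule K V} {H : ℤ → Submodule K W}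
    (hG : DirectSum.IsInternal G) (hH : DirectSum.IsInternal H) :
    DirectSum.IsInternal (fun i => (G i).prod (H i)) := by
  rw [DirectSum.isInternal_submodule_iff_iSupIndep_and_iSup_eq_top] at *
  obtain ⟨hG, hG'⟩ := hG
  obtain ⟨hH, hH'⟩ := hH
  rw [iSupIndep_iff_finsetSum_eq_zero_imp_eq_zero] at *
  refine ⟨fun s x hx h0 i hi => Prod.ext ?_ ?_, ?_⟩
  · exact hG s (fun i => (x i).1) (fun i hi => (hx i hi).1) (by rw [← Prod.fst_sum, h0]; rfl) i hi
  · exact hH s (fun i => (x i).2) (fun i hi => (hx i hi).2) (by rw [← Prod.snd_sum, h0]; rfl) i hi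
  · rw [eq_top_iff]
    rintro ⟨x, y⟩ -
    rw [← add_zero x, ← zero_add y, ← Prod.mk_add_mk]
    refine add_mem ?_ ?_
    · have hx : x ∈ ⨆ i, G i := by rw [hG']; trivial
      refine Submodule.iSup_induction G
        (motive := fun x => ((x, 0) : V × W) ∈ ⨆ i, (G i).prod (H i)) hx
        (fun i x hx => Submodule.mem_iSup_of_mem i ⟨hx, zero_mem _⟩) (zero_mem _)
        (fun x y hx hy => by simpa using add_mem hx hy)
    · have hy : y ∈ ⨆ i, H i := by rw [hH']; trivial
      refine Submodule.iSup_induction H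
        (motive := fun y => ((0, y) : V × W) ∈ ⨆ i, (G i).prod (H i)) hy
        (fun i x hx => Submodule.mem_iSup_of_mem i ⟨zero_mem _, hx⟩) (zero_mem _)
        (fun x y hx hy => by simpa using add_mem hx hy)

theorem isInternal_shift (X : DGComplex.{u, w} K) (c : ℤ) :
    DirectSum.IsInternal (fun i => X.grading (i + c)) := by
  rw [DirectSum.isInternal_submodule_iff_iSupIndep_and_iSup_eq_top]
  refine ⟨X.isInternal.submodule_iSupIndep.comp (f := fun i : ℤ => i + c)
    (add_left_injective c), ?_⟩
  rw [← X.isInternal.submodule_iSup_eq_top]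
  exact (Equiv.addRight c).iSup_comp (g := X.grading)

/-- The direct sum of two DG modules. -/
def prod (X Y : DGComplex.{u, w} K) : DGComplex.{u, w} K where
  carrier := X.carrier × Y.carrier
  grading i := (X.grading i).prod (Y.grading i)
  isInternal := X.isInternal.prod_submodule Y.isInternal
  d := X.d.prodMap Y.d
  d_mem i _ hx := ⟨X.d_mem i _ hx.1, Y.d_mem i _ hx.2⟩
  d_d x := Prod.ext (X.d_d x.1) (Y.d_d x.2)

theorem prod_sign_apply (X Y : DGComplex.{u, w} K) (x : (X.prod Y).carrier) :
    (X.prod Y).sign x = (X.sign x.1, Y.sign x.2) := by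
  refine (X.prod Y).induction (p := fun x => (X.prod Y).sign x = (X.sign x.1, Y.sign x.2))
    (fun i x hx => ?_) ?_ (fun x y hx hy => ?_) x
  · rw [(X.prod Y).sign_of_mem hx, X.sign_of_mem hx.1, Y.sign_of_mem hx.2]; rfl
  · rw [map_zero]
    exact Prod.ext (map_zero X.sign).symm (map_zero Y.sign).symm
  · rw [map_add, hx, hy]
    exact Prod.ext (map_add X.sign _ _).symm (map_add Y.sign _ _).symm

/-- The cocone (homotopy fibre) `X ⊕ Y[-1]` of `f : X → Y`, with differential
`(x, y) ↦ (d x, f x - d y)`. -/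
def cocone {X Y : DGComplex.{u, w} K} (f : Hom X Y) : DGComplex.{u, w} K where
  carrier := X.carrier × Y.carrier
  grading i := (X.grading i).prod (Y.grading (i + -1))
  isInternal := X.isInternal.prod_submodule (Y.isInternal_shift (-1))
  d := (X.d ∘ₗ LinearMap.fst K _ _).prod
    (f.toLinearMap ∘ₗ LinearMap.fst K _ _ - Y.d ∘ₗ LinearMap.snd K _ _)
  d_mem i x hx := by
    refine ⟨X.d_mem i _ hx.1, ?_⟩
    have h1 := f.map_mem i _ hx.1
    have h2 := Y.d_mem _ _ hx.2
    rw [show i + 1 + -1 = i by ring]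
    rw [show i + -1 + 1 = i by ring] at h2
    exact sub_mem h1 h2
  d_d x := by
    refine Prod.ext (X.d_d x.1) ?_
    change f.toLinearMap (X.d x.1) - Y.d (f.toLinearMap x.1 - Y.d x.2) = 0
    rw [f.map_d, map_sub, Y.d_d, sub_zero, sub_self]

/-- The second coordinate in degree `i` has degree `i - 1` in `Y`, hence the extra minus sign. -/
theorem cocone_sign_apply {X Y : DGComplex.{u, w} K} (f : Hom X Y) (x : (cocone f).carrier) :
    (cocone f).sign x = (X.sign x.1, - Y.sign x.2) := by
  refine (cocone f).induction (p := fun x => (cocone f).sign x = (X.sign x.1, - Y.sign x.2))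
    (fun i x hx => ?_) ?_ (fun x y hx hy => ?_) x
  · rw [(cocone f).sign_of_mem hx, X.sign_of_mem hx.1, Y.sign_of_mem hx.2, Int.negOnePow_add]
    refine Prod.ext rfl ?_
    change i.negOnePow • x.2 = _
    rcases Int.units_eq_one_or i.negOnePow with h | h <;> simp [h, Units.neg_smul]
  · rw [map_zero]
    exact Prod.ext (map_zero X.sign).symm (by
      change (0 : Y.carrier) = - Y.sign 0
      rw [map_zero, neg_zero])
  · rw [map_add, hx, hy]
    exact Prod.ext (map_add X.sign _ _).symm (by
      change - Y.sign x.2 + - Y.sign y.2 = - Y.sign (x.2 + y.2)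
      rw [map_add, neg_add])

theorem Hom.IsQuasiIso.cocone_isAcyclic {X Y : DGComplex.{u, w} K} {f : Hom X Y}
    (hf : f.IsQuasiIso) : (cocone f).IsAcyclic := by
  obtain ⟨inj, surj⟩ := f.isQuasiIso_iff.1 hf
  refine (isAcyclic_iff _).2 ?_
  rintro ⟨x, y⟩ hxy
  have hx : X.d x = 0 := congrArg Prod.fst hxy
  have hy : f.toLinearMap x - Y.d y = 0 := congrArg Prod.snd hxy
  obtain ⟨x0, rfl⟩ := inj x hx ⟨y, sub_eq_zero.1 hy⟩
  -- The primitive `x0` of `x` may miss `y` by the cocycle `f x0 - y`; subtracting a cocycle `x1`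
  -- from `x0` makes this error a coboundary without changing `d x0`.
  obtain ⟨x1, hx1, z, hz⟩ := surj (f.toLinearMap x0 - y) (by
    rw [map_sub, ← f.map_d, hy])
  refine ⟨(x0 - x1, -z), Prod.ext ?_ ?_⟩
  · change X.d x0 = X.d (x0 - x1)
    rw [map_sub, hx1, sub_zero]
  · change y = f.toLinearMap (x0 - x1) - Y.d (-z)
    rw [map_neg, ← hz, map_sub]
    abel

/-- The identity homomorphism. -/
def Hom.id (X : DGComplex.{u, w} K) : Hom X X where
  toLinearMap := LinearMap.id
  map_mem _ _ hx := hx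
  map_d _ := rfl

theorem Hom.id_isQuasiIso (X : DGComplex.{u, w} K) : (Hom.id X).IsQuasiIso :=
  (Hom.isQuasiIso_iff _).2 ⟨fun _ _ h => h, fun y hy => ⟨y, hy, 0, by
    rw [map_zero]; exact sub_self y⟩⟩

/-- The difference `X ⊕ Y → Z` of two homomorphisms. -/
def Hom.diff {X Y Z : DGComplex.{u, w} K} (a : Hom X Z) (b : Hom Y Z) : Hom (X.prod Y) Z where
  toLinearMap := a.toLinearMap ∘ₗ LinearMap.fst K _ _ - b.toLinearMap ∘ₗ LinearMap.snd K _ _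
  map_mem i _ hx := sub_mem (a.map_mem i _ hx.1) (b.map_mem i _ hx.2)
  map_d x := by
    change a.toLinearMap (X.d x.1) - b.toLinearMap (Y.d x.2) =
      Z.d (a.toLinearMap x.1 - b.toLinearMap x.2)
    rw [a.map_d, b.map_d, map_sub]

/-- The homotopy pullback of `X → Z ← Y`. -/
def homotopyPullback {X Y Z : DGComplex.{u, w} K} (a : Hom X Z) (b : Hom Y Z) :
    DGComplex.{u, w} K :=
  cocone (Hom.diff a b)

theorem homotopyPullback_sign_apply {X Y Z : DGComplex.{u, w} K} (a : Hom X Z) (b : Hom Y Z)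
    (x : (homotopyPullback a b).carrier) :
    (homotopyPullback a b).sign x = ((X.sign x.1.1, Y.sign x.1.2), - Z.sign x.2) :=
  (cocone_sign_apply (Hom.diff a b) x).trans (Prod.ext (prod_sign_apply X Y x.1) rfl)

/-- The projection of a homotopy pullback of `X → Z ← Y` to `X` is a quasi-isomorphism if
`Y → Z` is one. -/
theorem Hom.IsQuasiIso.homotopyPullback_fst {X Y Z W : DGComplex.{u, w} K} (a : Hom X Z)
    {b : Hom Y Z} (hb : b.IsQuasiIso)
    (e : W.carrier ≃ₗ[K] (X.carrier × Y.carrier) × Z.carrier)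
    (he : ∀ x, e (W.d x) = ((X.d (e x).1.1, Y.d (e x).1.2),
      a.toLinearMap (e x).1.1 - b.toLinearMap (e x).1.2 - Z.d (e x).2))
    (f : Hom W X) (hf : ∀ x, f.toLinearMap x = (e x).1.1) : f.IsQuasiIso := by
  -- `W` is compared with the pullback through `e` because the path algebra, to which this is
  -- applied, consists of endomorphisms rather than triples.
  obtain ⟨inj, surj⟩ := b.isQuasiIso_iff.1 hb
  refine f.isQuasiIso_iff.2 ⟨fun x hx => ?_, fun x hx => ?_⟩
  · rintro ⟨c, hc⟩
    have h := he x
    rw [hx, map_zero] at h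
    have h1 : Y.d (e x).1.2 = 0 := (congrArg (fun t => t.1.2) h).symm
    have h2 : a.toLinearMap (e x).1.1 - b.toLinearMap (e x).1.2 - Z.d (e x).2 = 0 :=
      (congrArg (fun t => t.2) h).symm
    rw [hf] at hc
    rw [hc, a.map_d] at h2
    obtain ⟨y0, hy0⟩ := inj _ h1 ⟨a.toLinearMap c - (e x).2, by
      rw [map_sub, eq_comm, ← sub_eq_zero, ← h2]; abel⟩
    -- `(c, y0)` already has the right differential in `X ⊕ Y`; the error in the `Z`-coordinate is a
    -- cocycle, and the cocycle `y1` removes it up to a coboundary.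
    obtain ⟨y1, hy1, z, hz⟩ := surj (a.toLinearMap c - b.toLinearMap y0 - (e x).2) (by
      rw [map_sub, map_sub, ← b.map_d, ← hy0, h2])
    refine ⟨e.symm ((c, y0 + y1), -z), e.injective ?_⟩
    rw [he, e.apply_symm_apply]
    refine Prod.ext (Prod.ext hc ?_) ?_
    · simp only [map_add, hy1, hy0, add_zero]
    · simp only [map_neg, ← hz, map_add]
      abel
  · obtain ⟨y, hy, z, hz⟩ := surj (a.toLinearMap x) (by rw [← a.map_d, hx, map_zero])
    refine ⟨e.symm ((x, y), -z), e.injective ?_, 0, ?_⟩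
    · rw [he, e.apply_symm_apply, map_zero]
      refine Prod.ext (Prod.ext hx hy) ?_
      simp only [map_neg, ← hz]
      abel_nf
      rfl
    · rw [hf, e.apply_symm_apply, sub_self, map_zero]

/-- The projection of a homotopy pullback of `X → Z ← Y` to `Y` is a quasi-isomorphism if
`X → Z` is one. -/
theorem Hom.IsQuasiIso.homotopyPullback_snd {X Y Z W : DGComplex.{u, w} K} {a : Hom X Z}
    (ha : a.IsQuasiIso) (b : Hom Y Z)
    (e : W.carrier ≃ₗ[K] (X.carrier × Y.carrier) × Z.carrier)
    (he : ∀ x, e (W.d x) = ((X.d (e x).1.1, Y.d (e x).1.2),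
      a.toLinearMap (e x).1.1 - b.toLinearMap (e x).1.2 - Z.d (e x).2))
    (f : Hom W Y) (hf : ∀ x, f.toLinearMap x = (e x).1.2) : f.IsQuasiIso := by
  -- Exchanging `X` and `Y` changes the sign of the difference `a - b`; negating the `Z`-coordinate
  -- absorbs it.
  refine ha.homotopyPullback_fst b (e.trans (((LinearEquiv.prodComm K _ _).prodCongr
    (LinearEquiv.neg K)))) (fun x => ?_) f hf
  rw [LinearEquiv.trans_apply, he]
  refine Prod.ext rfl ?_
  simp
  abel

end DGComplex

/-! ### The sign automorphism of a DG algebra. -/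

namespace DGAlgebra

variable {K : Type u} [CommRing K] (A : DGAlgebra.{u, v} K)

variable {A} in
/-- Induction on homogeneous elements. -/
theorem induction {p : A.carrier → Prop}
    (mem : ∀ (i : ℤ) (a : A.carrier), a ∈ A.grading i → p a) (zero : p 0)
    (add : ∀ a b, p a → p b → p (a + b)) (a : A.carrier) : p a :=
  A.toDGComplex.induction mem zero add a

/-- The linear automorphism `a ↦ (-1)ⁱ a` (for `a` of degree `i`) of a DG algebra. -/
noncomputable def signLinear : A.carrier →ₗ[K] A.carrier := A.toDGComplex.sign

variable {A} in
theorem signLinear_of_mem {i : ℤ} {a : A.carrier} (ha : a ∈ A.grading i) :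
    A.signLinear a = i.negOnePow • a :=
  A.toDGComplex.sign_of_mem ha

/-- The algebra automorphism `a ↦ (-1)ⁱ a` (for `a` of degree `i`) of a DG algebra. -/
noncomputable def signHom : A.carrier →ₐ[K] A.carrier :=
  AlgHom.ofLinearMap A.signLinear
    (by
      rw [signLinear_of_mem
        (show (1 : A.carrier) ∈ A.grading 0 from SetLike.GradedOne.one_mem), Int.negOnePow_zero,
        one_smul])
    (fun a b => by
      refine A.induction (p := fun a => A.signLinear (a * b) = A.signLinear a * A.signLinear b)
        (fun i a ha => ?_) (by simp) (fun x y hx hy => by simp only [add_mul, map_add, hx, hy]) a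
      refine A.induction (p := fun b => A.signLinear (a * b) = A.signLinear a * A.signLinear b)
        (fun j b hb => ?_) (by simp) (fun x y hx hy => by simp only [mul_add, map_add, hx, hy]) b
      rw [signLinear_of_mem ha, signLinear_of_mem hb, signLinear_of_mem
          (show a * b ∈ A.grading (i + j) from SetLike.GradedMul.mul_mem ha hb), Int.negOnePow_add]
      rcases Int.units_eq_one_or i.negOnePow with h | h <;>
      rcases Int.units_eq_one_or j.negOnePow with h' | h' <;>
      simp [h, h', Units.neg_smul])

variable {A} in
theorem signHom_of_mem {i : ℤ} {a : A.carrier} (ha : a ∈ A.grading i) :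
    A.signHom a = i.negOnePow • a :=
  A.signLinear_of_mem ha

end DGAlgebra

/-! ### Cocones of DG modules. -/

namespace DGModule

variable {K : Type u} [CommRing K] {A : DGAlgebra.{u, v} K}

/-- The action of `A` on the cocone `M ⊕ N[-1]`, twisted by signs on `N[-1]`. -/
@[reducible] noncomputable def coconeModule {M N : DGModule.{u, v, w} A} (f : Hom M N) :
    Module A.carrier (DGComplex.cocone f.toDGComplexHom).carrier :=
  { smul := fun a x => (a • x.1, A.signHom a • x.2)
    one_smul := fun x => Prod.ext (one_smul _ x.1) (by
      change A.signHom 1 • x.2 = x.2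
      rw [map_one, one_smul])
    mul_smul := fun a b x => Prod.ext (mul_smul a b x.1) (by
      change A.signHom (a * b) • x.2 = A.signHom a • A.signHom b • x.2
      rw [map_mul, mul_smul])
    smul_zero := fun a => Prod.ext (smul_zero a) (smul_zero (A.signHom a))
    smul_add := fun a x y => Prod.ext (smul_add a x.1 y.1) (smul_add (A.signHom a) x.2 y.2)
    add_smul := fun a b x => Prod.ext (add_smul a b x.1) (by
      change A.signHom (a + b) • x.2 = A.signHom a • x.2 + A.signHom b • x.2
      rw [map_add, add_smul])
    zero_smul := fun x => Prod.ext (zero_smul _ x.1) (by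
      change A.signHom 0 • x.2 = 0
      rw [map_zero, zero_smul]) }

/-- The cocone `M ⊕ N[-1]` of a homomorphism `M → N` of DG modules. The action on `N[-1]` is
twisted by signs. -/
noncomputable def cocone {M N : DGModule.{u, v, w} A} (f : Hom M N) : DGModule.{u, v, w} A :=
  letI := coconeModule f
  { toDGComplex := DGComplex.cocone f.toDGComplexHom
    isScalarTower := ⟨fun k a x => Prod.ext (smul_assoc k a x.1) (by
      change A.signHom (k • a) • x.2 = k • A.signHom a • x.2
      rw [map_smul, smul_assoc])⟩
    smul_mem := fun i j a x ha hx => by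
      refine ⟨M.smul_mem i j a x.1 ha hx.1, ?_⟩
      have h := N.smul_mem i _ a x.2 ha hx.2
      rw [← add_assoc] at h
      change A.signHom a • x.2 ∈ _
      rw [A.signHom_of_mem ha]
      rcases Int.units_eq_one_or i.negOnePow with h' | h' <;>
        simpa [h', Units.neg_smul] using h
    d_smul := fun i a x ha => by
      refine Prod.ext (M.d_smul i a x.1 ha) ?_
      -- The differential of the shifted summand is `-d`, and `f` maps into it with degree `1`; the
      -- twist of the action by `(-1)ⁱ` is what makes the Leibniz rule hold for both terms.
      change f.toLinearMap (a • x.1) - N.d (A.signHom a • x.2) = A.signHom (A.d a) • x.2 +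
        i.negOnePow • (A.signHom a • (f.toLinearMap x.1 - N.d x.2))
      have h := N.d_smul i a x.2 ha
      rw [A.signHom_of_mem ha, A.signHom_of_mem (A.d_mem _ _ ha), map_smul, Int.negOnePow_succ]
      rcases Int.units_eq_one_or i.negOnePow with h' | h' <;>
        simp only [h', one_smul, Units.neg_smul, neg_smul, map_neg, neg_neg, smul_sub] at h ⊢ <;>
        rw [h] <;> abel }

/-! ### Hom complexes: composition, signs, maps into a cocone. -/

section Hom

variable {L M N Q : DGModule.{u, v, w} A}

theorem comp_mem_homDeg {i j : ℤ} {f : M.carrier →ₗ[K] N.carrier} {g : L.carrier →ₗ[K] M.carrier}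
    (hf : f ∈ homDeg M N i) (hg : g ∈ homDeg L M j) : f ∘ₗ g ∈ homDeg L N (i + j) := by
  refine ⟨fun l m hm => ?_, fun l a m ha => ?_⟩
  · rw [add_assoc]
    exact hf.1 _ _ (hg.1 l m hm)
  · have e := hf.2 l a (g m) ha
    rw [LinearMap.comp_apply, LinearMap.comp_apply, hg.2 l a m ha, add_mul, Int.negOnePow_add]
    rcases Int.units_eq_one_or (i * l).negOnePow with h | h <;>
    rcases Int.units_eq_one_or (j * l).negOnePow with h' | h' <;>
    simp only [h, h', Units.neg_smul, one_smul, map_neg, mul_one, mul_neg, neg_neg] at e ⊢ <;>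
    simp only [e, neg_neg]

/-- A linear map which is homogeneous on homogeneous maps preserves `homTotal`. -/
theorem map_mem_homTotal (T : (L.carrier →ₗ[K] M.carrier) →ₗ[K] (N.carrier →ₗ[K] Q.carrier))
    (c : ℤ) (hT : ∀ i, ∀ f ∈ homDeg L M i, T f ∈ homDeg N Q (i + c))
    {f : L.carrier →ₗ[K] M.carrier} (hf : f ∈ homTotal L M) : T f ∈ homTotal N Q := by
  refine Submodule.iSup_induction (homDeg L M) (motive := fun f => T f ∈ homTotal N Q) hf
    (fun i f hf => Submodule.mem_iSup_of_mem (i + c) (hT i f hf)) ?_ (fun f g hf hg => ?_)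
  · rw [map_zero]; exact zero_mem _
  · rw [map_add]; exact add_mem hf hg

theorem comp_mem_homTotal {f : M.carrier →ₗ[K] N.carrier} {g : L.carrier →ₗ[K] M.carrier}
    (hf : f ∈ homTotal M N) (hg : g ∈ homTotal L M) : f ∘ₗ g ∈ homTotal L N := by
  refine Submodule.iSup_induction (homDeg M N) (motive := fun f => f ∘ₗ g ∈ homTotal L N) hf
    (fun i f hf => ?_) ?_ (fun f f' hf hf' => ?_)
  · exact map_mem_homTotal (LinearMap.llcomp K _ _ _ f) i
      (fun j g hg => by rw [add_comm]; exact comp_mem_homDeg hf hg) hg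
  · rw [LinearMap.zero_comp]; exact zero_mem _
  · rw [LinearMap.add_comp]; exact add_mem hf hf'

/-- Conjugation by signs: it multiplies a homogeneous map of degree `i` by `(-1)ⁱ`. -/
noncomputable def signConj (M N : DGModule.{u, v, w} A) :
    (M.carrier →ₗ[K] N.carrier) →ₗ[K] (M.carrier →ₗ[K] N.carrier) :=
  LinearMap.llcomp K M.carrier N.carrier N.carrier N.sign ∘ₗ LinearMap.lcomp K N.carrier M.sign

theorem signConj_apply (f : M.carrier →ₗ[K] N.carrier) (m : M.carrier) :
    signConj M N f m = N.sign (f (M.sign m)) := rfl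

theorem signConj_of_mem {i : ℤ} {f : M.carrier →ₗ[K] N.carrier} (hf : f ∈ homDeg M N i) :
    signConj M N f = i.negOnePow • f :=
  LinearMap.ext fun m => sign_conj M N hf m

theorem signConj_mem_homDeg {i : ℤ} {f : M.carrier →ₗ[K] N.carrier} (hf : f ∈ homDeg M N i) :
    signConj M N f ∈ homDeg M N i := by
  rw [signConj_of_mem hf]
  rcases Int.units_eq_one_or i.negOnePow with h | h <;> simpa [h, Units.neg_smul] using hf

theorem signConj_mem {f : M.carrier →ₗ[K] N.carrier} (hf : f ∈ homTotal M N) :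
    signConj M N f ∈ homTotal M N :=
  map_mem_homTotal (signConj M N) 0
    (fun i f hf => by rw [add_zero]; exact signConj_mem_homDeg hf) hf

theorem signConj_signConj (f : M.carrier →ₗ[K] N.carrier) : signConj M N (signConj M N f) = f := by
  ext m
  simp only [signConj_apply, DGComplex.sign_sign]

/-- The differential has odd degree, so it anticommutes with the sign. -/
theorem homD_signConj (f : M.carrier →ₗ[K] N.carrier) :
    homD M N (signConj M N f) = - signConj M N (homD M N f) := by
  ext m
  simp only [LinearMap.neg_apply, signConj_apply, homD_apply, map_sub, DGComplex.sign_sign,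
    DGComplex.sign_d, map_neg]
  abel

/-- The Leibniz rule for composition of maps that need not be homogeneous. -/
theorem homD_comp_eq (f : M.carrier →ₗ[K] N.carrier) (g : L.carrier →ₗ[K] M.carrier) :
    homD L N (f ∘ₗ g) = homD M N f ∘ₗ g + signConj M N f ∘ₗ homD L M g := by
  ext m
  simp only [LinearMap.add_apply, LinearMap.comp_apply, signConj_apply, homD_apply, map_sub,
    DGComplex.sign_sign]
  abel

/-- The Leibniz rule puts a sign conjugation on the left factor, and conjugating twice does nothing.
This turns a primitive of `homD L M g` into one of its composite with a cocycle `f` that need not be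
homogeneous. -/
theorem homD_comp_of_eq_zero_left {f : M.carrier →ₗ[K] N.carrier} (hf : homD M N f = 0)
    (g : L.carrier →ₗ[K] M.carrier) :
    homD L N (signConj M N f ∘ₗ g) = f ∘ₗ homD L M g := by
  rw [homD_comp_eq, signConj_signConj, homD_signConj, hf, map_zero, neg_zero, LinearMap.zero_comp,
    zero_add]

theorem homD_comp_of_eq_zero_right (f : M.carrier →ₗ[K] N.carrier) {g : L.carrier →ₗ[K] M.carrier}
    (hg : homD L M g = 0) : homD L N (f ∘ₗ g) = homD M N f ∘ₗ g := by
  rw [homD_comp_eq, hg, LinearMap.comp_zero, add_zero]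

theorem homD_id : homD M M LinearMap.id = 0 := by
  ext m
  simp [homD_apply, DGComplex.sign_sign]

theorem id_mem_homTotal : (LinearMap.id : M.carrier →ₗ[K] M.carrier) ∈ homTotal M M :=
  Submodule.mem_iSup_of_mem 0 (one_mem_homDeg M)

/-- The `K`-linear map underlying a homomorphism of DG modules. -/
abbrev Hom.toK (f : Hom M N) : M.carrier →ₗ[K] N.carrier := f.toLinearMap.restrictScalars K

theorem Hom.toK_mem_homDeg (f : Hom M N) : f.toK ∈ homDeg M N 0 :=
  ⟨fun j m hm => by simpa using f.map_mem j m hm, fun j a m _ => by simp⟩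

theorem Hom.toK_mem (f : Hom M N) : f.toK ∈ homTotal M N :=
  Submodule.mem_iSup_of_mem 0 f.toK_mem_homDeg

theorem Hom.homD_toK (f : Hom M N) : homD M N f.toK = 0 := by
  ext m
  rw [homD_of_mem M N f.toK_mem_homDeg, Int.negOnePow_zero, one_smul, LinearMap.zero_apply]
  exact sub_eq_zero.2 (f.map_d m).symm

theorem Hom.signConj_toK (f : Hom M N) : signConj M N f.toK = f.toK := by
  rw [signConj_of_mem f.toK_mem_homDeg, Int.negOnePow_zero, one_smul]

/-- A cocycle of degree `0` in `Hom_A(M, N)` is a homomorphism of DG modules. -/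
theorem exists_hom_of_mem_homDeg {f : M.carrier →ₗ[K] N.carrier} (hf : f ∈ homDeg M N 0)
    (hd : homD M N f = 0) : ∃ φ : Hom M N, φ.toK = f := by
  refine ⟨{ toFun := f, map_add' := map_add f, map_smul' := fun a m => ?_, map_mem := ?_,
            map_d := fun m => ?_ }, rfl⟩
  · refine A.induction (p := fun a => f (a • m) = a • f m)
      (fun i a ha => ?_) ?_ ?_ a
    · simpa using hf.2 i a m ha
    · simp
    · intro a b ha hb
      rw [add_smul, add_smul, map_add, ha, hb]
  · intro i m hm
    simpa using hf.1 i m hm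
  · have h := homD_of_mem M N hf m
    rw [hd, Int.negOnePow_zero, one_smul, LinearMap.zero_apply] at h
    exact (sub_eq_zero.1 h.symm).symm

/-- The homomorphism `Hom_A(L, M) → Hom_A(L, N)` given by composition with `M → N`. -/
noncomputable def homPost (L : DGModule.{u, v, w} A) (f : Hom M N) :
    DGComplex.Hom (homComplex L M) (homComplex L N) where
  toLinearMap := (LinearMap.llcomp K _ _ _ f.toK).restrict
    (fun _ hg => comp_mem_homTotal f.toK_mem hg)
  map_mem i g hg := by
    have h := comp_mem_homDeg f.toK_mem_homDeg (g := g.1) hg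
    rw [zero_add] at h
    exact h
  map_d g := Subtype.ext (by
    change f.toK ∘ₗ homD L M g.1 = homD L N (f.toK ∘ₗ g.1)
    rw [← homD_comp_of_eq_zero_left f.homD_toK, f.signConj_toK])

/-- The homomorphism `Hom_A(N, L) → Hom_A(M, L)` given by composition with `M → N`. -/
noncomputable def homPre (f : Hom M N) (L : DGModule.{u, v, w} A) :
    DGComplex.Hom (homComplex N L) (homComplex M L) where
  toLinearMap := (LinearMap.lcomp K L.carrier f.toK).restrict
    (fun _ hg => comp_mem_homTotal hg f.toK_mem)
  map_mem i g hg := by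
    have h := comp_mem_homDeg (f := g.1) hg f.toK_mem_homDeg
    rw [add_zero] at h
    exact h
  map_d g := Subtype.ext (by
    change homD N L g.1 ∘ₗ f.toK = homD M L (g.1 ∘ₗ f.toK)
    rw [homD_comp_of_eq_zero_right _ f.homD_toK])

theorem fst_mem_homTotal {f : Hom M N} {g : L.carrier →ₗ[K] (cocone f).carrier}
    (hg : g ∈ homTotal L (cocone f)) :
    LinearMap.fst K M.carrier N.carrier ∘ₗ g ∈ homTotal L M :=
  map_mem_homTotal (M := cocone f) (LinearMap.llcomp K L.carrier (cocone f).carrier M.carrier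
    (LinearMap.fst K M.carrier N.carrier)) 0 (fun i g hg => by
    rw [add_zero]
    refine ⟨fun j m hm => (hg.1 j m hm).1, fun j a m ha => congrArg Prod.fst (hg.2 j a m ha)⟩) hg

/-- The projection to the shifted summand lowers degrees by one. The sign `(-1)ʲ` in the action on
that summand is the quotient of the linearity signs for degrees `i` and `i - 1`. -/
theorem snd_mem_homTotal {f : Hom M N} {g : L.carrier →ₗ[K] (cocone f).carrier}
    (hg : g ∈ homTotal L (cocone f)) :
    LinearMap.snd K M.carrier N.carrier ∘ₗ g ∈ homTotal L N :=
  map_mem_homTotal (M := cocone f) (LinearMap.llcomp K L.carrier (cocone f).carrier N.carrier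
    (LinearMap.snd K M.carrier N.carrier)) (-1) (fun i g hg => by
    refine ⟨fun j m hm => ?_, fun j a m ha => ?_⟩
    · rw [show i + -1 + j = i + j + -1 by ring]
      exact (hg.1 j m hm).2
    · refine (congrArg Prod.snd (hg.2 j a m ha)).trans ?_
      change (i * j).negOnePow • (A.signHom a • (g m).2) =
        ((i + -1) * j).negOnePow • (a • (g m).2)
      rw [A.signHom_of_mem ha, add_mul, Int.negOnePow_add, neg_one_mul, Int.negOnePow_neg]
      rcases Int.units_eq_one_or j.negOnePow with h | h <;>
        simp [h, Units.neg_smul]) hg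

theorem prod_mem_homDeg (f : Hom M N) {i : ℤ} {g : L.carrier →ₗ[K] M.carrier}
    {h : L.carrier →ₗ[K] N.carrier} (hg : g ∈ homDeg L M i) (hh : h ∈ homDeg L N (i + -1)) :
    (g.prod h : L.carrier →ₗ[K] (cocone f).carrier) ∈ homDeg L (cocone f) i := by
  refine ⟨fun j m hm => ⟨hg.1 j m hm, ?_⟩, fun j a m ha => Prod.ext (hg.2 j a m ha) ?_⟩
  · rw [show i + j + -1 = i + -1 + j by ring]
    exact hh.1 j m hm
  · change h (a • m) = (i * j).negOnePow • (A.signHom a • h m)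
    rw [hh.2 j a m ha, A.signHom_of_mem ha, add_mul, Int.negOnePow_add, neg_one_mul,
      Int.negOnePow_neg]
    rcases Int.units_eq_one_or j.negOnePow with h | h <;> simp [h, Units.neg_smul]

theorem prod_mem_homTotal (f : Hom M N) {g : L.carrier →ₗ[K] M.carrier}
    {h : L.carrier →ₗ[K] N.carrier} (hg : g ∈ homTotal L M) (hh : h ∈ homTotal L N) :
    (g.prod h : L.carrier →ₗ[K] (cocone f).carrier) ∈ homTotal L (cocone f) := by
  have h1 := map_mem_homTotal (N := L) (Q := cocone f)
    (LinearMap.llcomp K L.carrier M.carrier (cocone f).carrier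
      (LinearMap.inl K M.carrier N.carrier)) 0 (fun i g hg => by
      rw [add_zero]; exact prod_mem_homDeg f hg (h := 0) (zero_mem _)) hg
  have h2 := map_mem_homTotal (N := L) (Q := cocone f)
    (LinearMap.llcomp K L.carrier N.carrier (cocone f).carrier
      (LinearMap.inr K M.carrier N.carrier)) 1 (fun i h hh =>
      prod_mem_homDeg f (g := 0) (zero_mem _) (by
        rw [show i + 1 + -1 = i by ring]; exact hh)) hh
  refine (congrArg (· ∈ homTotal L (cocone f)) (LinearMap.ext fun m => ?_)).mpr (add_mem h1 h2)
  exact Prod.ext (add_zero (g m)).symm (zero_add (h m)).symm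

/-- `Hom_A(L, -)` commutes with cocones: in coordinates this is the differential of the cocone of
`homPost L f`. The minus sign in `cocone_sign_apply` gives the correct sign on the second component.
-/
theorem homD_cocone_apply (f : Hom M N) (g : L.carrier →ₗ[K] (cocone f).carrier) (m : L.carrier) :
    homD L (cocone f) g m = (homD L M (LinearMap.fst K M.carrier N.carrier ∘ₗ g) m,
      f.toK (g m).1 - homD L N (LinearMap.snd K M.carrier N.carrier ∘ₗ g) m) := by
  rw [homD_apply]
  have e := DGComplex.cocone_sign_apply f.toDGComplexHom (g (L.sign (L.d m)))
  refine Prod.ext (congrArg (fun t => M.d (g m).1 - t.1) e) ?_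
  refine (congrArg (fun t => f.toK (g m).1 - N.d (g m).2 - t.2) e).trans ?_
  simp only [homD_apply]
  abel

end Hom

/-! ### K-projective DG modules and quasi-isomorphisms. -/

variable {M N P P' : DGModule.{u, v, w} A}

/-- A quasi-isomorphism `M → N` induces a quasi-isomorphism `Hom_A(P, M) → Hom_A(P, N)` if `P` is
K-projective. -/
theorem IsKProjective.homPost_isQuasiIso (hP : P.IsKProjective) {f : Hom M N}
    (hf : f.IsQuasiIso) : (homPost P f).IsQuasiIso := by
  have ac := (DGComplex.isAcyclic_iff _).1
    (hP (cocone f) (DGComplex.Hom.IsQuasiIso.cocone_isAcyclic hf))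
  -- Acyclicity of `Hom_A(P, cocone f)` in coordinates: a cocycle `(g, h)` is the coboundary of some
  -- `(g', h')`. An arbitrary `g` will give injectivity, and `g = 0` surjectivity.
  have key : ∀ (g : P.carrier →ₗ[K] M.carrier) (h : P.carrier →ₗ[K] N.carrier),
      g ∈ homTotal P M → h ∈ homTotal P N → homD P M g = 0 → f.toK ∘ₗ g = homD P N h →
      ∃ g' ∈ homTotal P M, ∃ h' ∈ homTotal P N,
        g = homD P M g' ∧ h = f.toK ∘ₗ g' - homD P N h' := by
    intro g h hg hh hg0 hgh
    obtain ⟨⟨t, ht⟩, e⟩ := ac ⟨_, prod_mem_homTotal f hg hh⟩ (Subtype.ext (by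
      change homD P (cocone f) _ = 0
      ext m
      rw [homD_cocone_apply]
      refine Prod.ext (DFunLike.congr_fun hg0 m) ?_
      exact sub_eq_zero.2 (DFunLike.congr_fun hgh m)))
    have e' : ∀ m, (g m, h m) = homD P (cocone f) t m := fun m =>
      DFunLike.congr_fun (congrArg Subtype.val e) m
    simp only [homD_cocone_apply] at e'
    exact ⟨_, fst_mem_homTotal ht, _, snd_mem_homTotal ht,
      LinearMap.ext fun m => congrArg Prod.fst (e' m),
      LinearMap.ext fun m => congrArg Prod.snd (e' m)⟩
  refine (DGComplex.Hom.isQuasiIso_iff _).2 ⟨?_, ?_⟩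
  · rintro ⟨g, hg⟩ hg0 ⟨⟨h, hh⟩, e⟩
    obtain ⟨g', hg', -, -, e', -⟩ := key g h hg hh (congrArg Subtype.val hg0)
      (congrArg Subtype.val e)
    exact ⟨⟨g', hg'⟩, Subtype.ext e'⟩
  · rintro ⟨h, hh⟩ hh0
    have hh0' : homD P N h = 0 := congrArg Subtype.val hh0
    obtain ⟨g', hg', h', hh', e, e'⟩ := key 0 h (zero_mem _) hh (map_zero _)
      (by rw [hh0', LinearMap.comp_zero])
    refine ⟨⟨g', hg'⟩, Subtype.ext e.symm, ⟨h', hh'⟩, Subtype.ext ?_⟩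
    change f.toK ∘ₗ g' - h = homD P N h'
    rw [e', sub_sub_cancel]

/-- A quasi-isomorphism `P → P'` between K-projective DG modules induces a quasi-isomorphism
`Hom_A(P', N) → Hom_A(P, N)`. -/
theorem IsKProjective.homPre_isQuasiIso (hP : P.IsKProjective) (hP' : P'.IsKProjective)
    {f : Hom P P'} (hf : f.IsQuasiIso) (N : DGModule.{u, v, w} A) : (homPre f N).IsQuasiIso := by
  -- Lifting the identity of `P'` through `f` gives a right inverse `s` of `f` up to the homotopy
  -- `η`. Cohomology is total, so `s` need not be homogeneous.
  obtain ⟨⟨s, hs⟩, hs0, ⟨η, hη⟩, e⟩ :=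
    ((DGComplex.Hom.isQuasiIso_iff _).1 (hP'.homPost_isQuasiIso hf)).2
      ⟨LinearMap.id, id_mem_homTotal⟩ (Subtype.ext homD_id)
  have hs0 : homD P' P s = 0 := congrArg Subtype.val hs0
  have e : f.toK ∘ₗ s - LinearMap.id = homD P' P' η := congrArg Subtype.val e
  have hsf : homD P P (s ∘ₗ f.toK - LinearMap.id) = 0 := by
    rw [map_sub, homD_id, homD_comp_of_eq_zero_right _ f.homD_toK, hs0, LinearMap.zero_comp,
      sub_zero]
  have hfs : f.toK ∘ₗ (s ∘ₗ f.toK - LinearMap.id) = homD P P' (η ∘ₗ f.toK) := by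
    rw [homD_comp_of_eq_zero_right _ f.homD_toK, ← e, LinearMap.comp_sub, LinearMap.sub_comp]
    rfl
  -- The cocycle `s f - 1` becomes a coboundary after composition with `f`, hence is one itself: `s`
  -- is also a left inverse, up to `θ`.
  obtain ⟨⟨θ, hθ⟩, e'⟩ := ((DGComplex.Hom.isQuasiIso_iff _).1 (hP.homPost_isQuasiIso hf)).1
    ⟨s ∘ₗ f.toK - LinearMap.id,
      sub_mem (comp_mem_homTotal hs f.toK_mem) id_mem_homTotal⟩
    (Subtype.ext hsf) ⟨⟨η ∘ₗ f.toK, comp_mem_homTotal hη f.toK_mem⟩, Subtype.ext hfs⟩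
  have e' : s ∘ₗ f.toK - LinearMap.id = homD P P θ := congrArg Subtype.val e'
  refine (DGComplex.Hom.isQuasiIso_iff _).2 ⟨?_, ?_⟩
  · rintro ⟨g, hg⟩ hg0 ⟨⟨k, hk⟩, e1⟩
    have hg0 : homD P' N g = 0 := congrArg Subtype.val hg0
    have e1 : g ∘ₗ f.toK = homD P N k := congrArg Subtype.val e1
    -- Write `g = (g f) s - g (f s - 1)`; the terms have primitives `k s` and, up to signs, `g η`.
    refine ⟨⟨k ∘ₗ s - signConj P' N g ∘ₗ η, sub_mem (comp_mem_homTotal hk hs)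
      (comp_mem_homTotal (signConj_mem hg) hη)⟩, Subtype.ext ?_⟩
    change g = homD P' N (k ∘ₗ s - signConj P' N g ∘ₗ η)
    rw [map_sub, homD_comp_of_eq_zero_right _ hs0, homD_comp_of_eq_zero_left hg0, ← e, ← e1,
      LinearMap.comp_sub, LinearMap.comp_assoc, sub_sub_cancel, LinearMap.comp_id]
  · rintro ⟨k, hk⟩ hk0
    have hk0 : homD P N k = 0 := congrArg Subtype.val hk0
    refine ⟨⟨k ∘ₗ s, comp_mem_homTotal hk hs⟩, Subtype.ext ?_,
      ⟨signConj P N k ∘ₗ θ, comp_mem_homTotal (signConj_mem hk) hθ⟩, Subtype.ext ?_⟩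
    · change homD P' N (k ∘ₗ s) = 0
      rw [homD_comp_of_eq_zero_right _ hs0, hk0, LinearMap.zero_comp]
    · change (k ∘ₗ s) ∘ₗ f.toK - k = homD P N (signConj P N k ∘ₗ θ)
      rw [homD_comp_of_eq_zero_left hk0, ← e', LinearMap.comp_sub, LinearMap.comp_assoc,
        LinearMap.comp_id]

/-- K-projective resolutions of the same DG module are quasi-isomorphic. -/
theorem IsKProjective.exists_isQuasiIso (hP : P.IsKProjective) {p : Hom P M} (hp : p.IsQuasiIso)
    {p' : Hom P' M} (hp' : p'.IsQuasiIso) : ∃ f : Hom P P', f.IsQuasiIso := by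
  -- The pair `(0, p)` is a cocycle in `Hom_A(P, cocone p')`. A primitive `(f, h)` of it satisfies
  -- `d f = 0` and `p = p' f - d h`, so it is a lift of `p` together with a homotopy.
  obtain ⟨⟨t, ht⟩, ht0⟩ := (DGComplex.isAcyclic_iff _).1
    (hP (cocone p') (DGComplex.Hom.IsQuasiIso.cocone_isAcyclic hp'))
    ⟨_, prod_mem_homTotal p' (zero_mem _) p.toK_mem⟩ (Subtype.ext (by
      change homD P (cocone p') _ = 0
      ext m
      rw [homD_cocone_apply]
      refine Prod.ext (DFunLike.congr_fun (map_zero (homD P P')) m) ?_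
      change p'.toK 0 - homD P M p.toK m = 0
      rw [p.homD_toK, map_zero, LinearMap.zero_apply, sub_zero]))
  -- Because of the shift, `(0, p)` has degree `1`. A primitive of degree `0` is needed for its
  -- first component to be a homomorphism of DG modules.
  obtain ⟨⟨s, hs⟩, hs', e⟩ := (homComplex P (cocone p')).exists_mem_grading_of_eq_d
    (i := 0) (y := ⟨t, ht⟩) (by
      rw [← ht0]
      exact prod_mem_homDeg p' (zero_mem _) (by simpa using p.toK_mem_homDeg))
  have hs' : s ∈ homDeg P (cocone p') 0 := hs'
  have e' : ∀ m, ((0 : P'.carrier), p.toK m) = homD P (cocone p') s m := fun m =>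
    DFunLike.congr_fun (congrArg Subtype.val (ht0.trans e)) m
  simp only [homD_cocone_apply] at e'
  obtain ⟨f, hf⟩ := exists_hom_of_mem_homDeg (M := P) (N := P')
    (f := LinearMap.fst K P'.carrier M.carrier ∘ₗ s)
    ⟨fun j m hm => (hs'.1 j m hm).1, fun j a m ha => congrArg Prod.fst (hs'.2 j a m ha)⟩
    (LinearMap.ext fun m => (congrArg Prod.fst (e' m)).symm)
  obtain ⟨h, hh⟩ : ∃ h, h = LinearMap.snd K P'.carrier M.carrier ∘ₗ s := ⟨_, rfl⟩
  -- On cocycles `p` and `p' f` differ by coboundaries; the rest is the two-out-of-three argument.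
  have key : ∀ m, P.d m = 0 → p.toLinearMap m = p'.toLinearMap (f.toLinearMap m) - M.d (h m) := by
    intro m hm
    have h1 : p.toLinearMap m = p'.toLinearMap (f.toK m) - homD P M h m := by
      rw [hf, hh]; exact congrArg Prod.snd (e' m)
    rw [homD_apply, hm, map_zero, map_zero, map_zero, sub_zero] at h1
    exact h1
  obtain ⟨inj, surj⟩ := (DGComplex.Hom.isQuasiIso_iff _).1 hp
  obtain ⟨inj', surj'⟩ := (DGComplex.Hom.isQuasiIso_iff _).1 hp'
  refine ⟨f, (DGComplex.Hom.isQuasiIso_iff _).2 ⟨?_, ?_⟩⟩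
  · rintro x hx ⟨y, hy⟩
    refine inj x hx ⟨p'.toLinearMap y - h x, ?_⟩
    have hy : f.toLinearMap x = P'.d y := hy
    refine (key x hx).trans ?_
    rw [hy, p'.map_d, map_sub]
  · intro y hy
    obtain ⟨x, hx, z, hz⟩ := surj (p'.toLinearMap y) (by rw [← p'.map_d, hy, map_zero])
    have hz : p.toLinearMap x - p'.toLinearMap y = M.d z := hz
    refine ⟨x, hx, inj' _ ?_ ⟨z + h x, ?_⟩⟩
    · change P'.d (f.toLinearMap x - y) = 0
      rw [map_sub, ← f.map_d, hx, map_zero, hy, sub_zero]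
    · change p'.toLinearMap (f.toLinearMap x - y) = _
      rw [map_sub, map_add, ← hz, key x hx]
      abel

end DGModule

/-! ### DG `K`-modules as DG modules over the base ring. -/

namespace DGAlgebra

/-- The base ring as a DG algebra concentrated in degree `0`. -/
noncomputable def base (K : Type u) [CommRing K] : DGAlgebra.{u, u} K where
  carrier := K
  grading i := if i = 0 then ⊤ else ⊥
  gradedMonoid :=
    { one_mem := by simp
      mul_mem := fun i j a b ha hb => by
        by_cases hi : i = 0
        · by_cases hj : j = 0
          · simp [hi, hj]
          · obtain rfl : b = 0 := by simpa [hj] using hb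
            simp
        · obtain rfl : a = 0 := by simpa [hi] using ha
          simp }
  isInternal := by
    rw [DirectSum.isInternal_submodule_iff_iSupIndep_and_iSup_eq_top]
    refine ⟨?_, ?_⟩
    · rw [iSupIndep_iff_finsetSum_eq_zero_imp_eq_zero]
      intro s x hx h0 i hi
      have h : ∀ j ∈ s, j ≠ 0 → x j = 0 := fun j hj hj0 => by simpa [hj0] using hx j hj
      by_cases hi0 : i = 0
      · subst hi0
        rwa [Finset.sum_eq_single_of_mem 0 hi h] at h0
      · exact h i hi hi0
    · exact eq_top_iff.2 (le_iSup_of_le 0 (by simp))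
  d := 0
  d_mem i a ha := zero_mem _
  d_d a := rfl
  d_mul i a b ha := by simp

end DGAlgebra

/-- A DG `K`-module as a DG module over the DG algebra `K`. -/
noncomputable def DGComplex.toDGModule {K : Type u} [CommRing K] (X : DGComplex.{u, w} K) :
    DGModule.{u, u, w} (DGAlgebra.base K) where
  toDGComplex := X
  moduleA := inferInstanceAs (Module K X.carrier)
  isScalarTower := inferInstanceAs (IsScalarTower K K X.carrier)
  smul_mem i j a m ha hm := by
    by_cases hi : i = 0
    · subst hi
      rw [zero_add]
      exact Submodule.smul_mem (X.grading j) (show K from a) hm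
    · obtain rfl : a = 0 := by
        have ha : a ∈ (if i = 0 then (⊤ : Submodule K K) else ⊥) := ha
        rwa [if_neg hi] at ha
      exact (congrArg (· ∈ X.grading (i + j)) (zero_smul K m)).mpr (zero_mem _)
  d_smul i a m ha := by
    by_cases hi : i = 0
    · subst hi
      rw [Int.negOnePow_zero, one_smul]
      refine (X.d.map_smul (show K from a) m).trans ?_
      exact ((congrArg (· + (show K from a) • X.d m) (zero_smul K m)).trans (zero_add _)).symm
    · obtain rfl : a = 0 := by
        have ha : a ∈ (if i = 0 then (⊤ : Submodule K K) else ⊥) := ha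
        rwa [if_neg hi] at ha
      have h1 : ∀ m : X.carrier, (0 : K) • m = 0 := zero_smul K
      change X.d ((0 : K) • m) = (0 : K) • m + i.negOnePow • ((0 : K) • X.d m)
      rw [h1, h1, map_zero, smul_zero, add_zero]

/-- Nonzero homogeneous scalars have degree `0`, where the linearity sign is trivial, so only the
degree condition remains. The general theory of `homDeg` and `homD` thus applies to `K`-linear
endomorphisms. -/
theorem DGComplex.mem_homDeg_toDGModule {K : Type u} [CommRing K] {X Y : DGComplex.{u, w} K}
    {i : ℤ} {f : X.carrier →ₗ[K] Y.carrier}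
    (hf : ∀ (j : ℤ) (m : X.carrier), m ∈ X.grading j → f m ∈ Y.grading (i + j)) :
    f ∈ DGModule.homDeg X.toDGModule Y.toDGModule i := by
  refine ⟨hf, fun j a m ha => ?_⟩
  by_cases hj : j = 0
  · subst hj
    rw [mul_zero, Int.negOnePow_zero, one_smul]
    exact f.map_smul (show K from a) m
  · obtain rfl : a = 0 := by
      have ha : a ∈ (if j = 0 then (⊤ : Submodule K K) else ⊥) := ha
      rwa [if_neg hj] at ha
    have h1 : ∀ m : X.carrier, (0 : K) • m = 0 := zero_smul K
    have h2 : ∀ m : Y.carrier, (0 : K) • m = 0 := zero_smul K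
    exact (congrArg f (h1 m)).trans ((map_zero f).trans
      ((congrArg ((i * j).negOnePow • ·) (h2 (f m))).trans (smul_zero _)).symm)

namespace DGModule

variable {K : Type u} [CommRing K] {A : DGAlgebra.{u, v} K}

/-! ### DG subalgebras of an endomorphism algebra. -/

section SubEnd

variable (M : DGModule.{u, v, w} A) (S : Subalgebra K (Module.End K M.carrier))
  (G : ℤ → Submodule K (Module.End K M.carrier)) (hS : Subalgebra.toSubmodule S = ⨆ i, G i)
  (hG : ∀ i, G i ≤ homDeg M M i) (one_mem : 1 ∈ G 0)
  (mul_mem : ∀ i j, ∀ f ∈ G i, ∀ g ∈ G j, f * g ∈ G (i + j))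
  (hd : ∀ i, ∀ f ∈ G i, homD M M f ∈ G (i + 1))

/-- The DG subalgebra of `End_A(M)` with homogeneous parts `G i`. -/
noncomputable def subEndAlgebra : DGAlgebra.{u, w} K where
  carrier := S
  grading i := (G i).comap S.val.toLinearMap
  gradedMonoid :=
    { one_mem := one_mem
      mul_mem := fun i j _ _ hf hg => mul_mem i j _ hf _ hg }
  isInternal := isInternal_comap G ((homDeg_iSupIndep M M).mono hG) (Subalgebra.toSubmodule S) hS
  d := (homD M M).restrict (p := Subalgebra.toSubmodule S) (q := Subalgebra.toSubmodule S) (by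
    intro f hf
    rw [hS] at hf ⊢
    refine Submodule.iSup_induction G (motive := fun f => homD M M f ∈ ⨆ i, G i) hf
      (fun i f hf => Submodule.mem_iSup_of_mem (i + 1) (hd i f hf)) ?_ (fun f g hf hg => ?_)
    · rw [map_zero]; exact zero_mem _
    · rw [map_add]; exact add_mem hf hg)
  d_mem i f hf := hd i f.1 hf
  d_d f := Subtype.ext (homD_homD M M f.1 (by
    have hf : f.1 ∈ Subalgebra.toSubmodule S := f.2
    rw [hS] at hf
    exact iSup_mono hG hf))
  d_mul i f g hf := Subtype.ext (homD_comp M (hG i hf) g.1)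

/-- `M` as a DG module over a DG subalgebra of `End_A(M)`. -/
noncomputable def overSubEnd : DGModule.{u, w, w} (subEndAlgebra M S G hS hG one_mem mul_mem hd) where
  toDGComplex := M.toDGComplex
  moduleA := inferInstanceAs (Module S M.carrier)
  isScalarTower := inferInstanceAs (IsScalarTower K S M.carrier)
  smul_mem i j f m hf hm := (hG i hf).1 j m hm
  d_smul i f m hf := by
    have e := homD_of_mem M M (hG i hf) m
    change M.d (f.1 m) = homD M M f.1 m + i.negOnePow • f.1 (M.d m)
    exact (congrArg (fun x => x + i.negOnePow • f.1 (M.d m)) e |>.trans (sub_add_cancel _ _)).symm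

end SubEnd

/-! ### Triangular endomorphisms of the mapping path object. -/

variable {P P' : DGModule.{u, v, w} A} (φ : Hom P P')

/-- The mapping path object `P ⊕ P' ⊕ P'[-1]` of a homomorphism `P → P'`. -/
def pathObject : DGComplex.{u, w} K :=
  DGComplex.homotopyPullback φ.toDGComplexHom (DGComplex.Hom.id P'.toDGComplex)

/-- The homotopy pullback of `End_A(P) → Hom_A(P, P') ← End_A(P')`. -/
noncomputable def endPullback : DGComplex.{u, w} K :=
  DGComplex.homotopyPullback (homPost P φ) (homPre φ P')

/-- The endomorphism `(p, p', y) ↦ (b p, b' p', h p ± b' y)` of the mapping path object. -/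
noncomputable def pathEnd :
    (endPullback φ).carrier →ₗ[K] Module.End K (pathObject φ).toDGModule.carrier :=
  let E : (homTotal P P × homTotal P' P') × homTotal P P' →ₗ[K]
      ((P.carrier × P'.carrier) × P'.carrier →ₗ[K] (P.carrier × P'.carrier) × P'.carrier) :=
    { toFun := fun t => ((t.1.1.1.prodMap t.1.2.1) ∘ₗ LinearMap.fst K _ _).prod
        (t.2.1 ∘ₗ LinearMap.fst K _ _ ∘ₗ LinearMap.fst K _ _ +
          -- On the shifted copy of `P'` an element of degree `i` acts with the sign `(-1)ⁱ`.
          signConj P' P' t.1.2.1 ∘ₗ LinearMap.snd K _ _)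
      map_add' := fun s t => LinearMap.ext fun x => Prod.ext rfl (by
        simp
        abel)
      map_smul' := fun k t => LinearMap.ext fun x => Prod.ext rfl (by simp) }
  E

theorem pathEnd_injective : Function.Injective (pathEnd φ) := by
  intro s t hst
  have e : ∀ x, pathEnd φ s x = pathEnd φ t x := fun x => by rw [hst]
  refine Prod.ext (Prod.ext (Subtype.ext (LinearMap.ext fun p => ?_))
    (Subtype.ext (LinearMap.ext fun p => ?_))) (Subtype.ext (LinearMap.ext fun p => ?_))
  · exact congrArg (fun x => x.1.1) (e ((p, 0), 0))
  · exact congrArg (fun x => x.1.2) (e ((0, p), 0))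
  · have h : s.2.1 p + P'.sign (s.1.2.1 (P'.sign 0)) = t.2.1 p + P'.sign (t.1.2.1 (P'.sign 0)) :=
      congrArg (fun x => x.2) (e ((p, 0), 0))
    simpa only [map_zero, add_zero] using h

/-- The commutator with the differential of the path object stays triangular: the two contributions
of `b' p'` to the corner cancel, as the same `b'` acts on `P'` and, up to sign, on `P'[-1]`. The
corner that remains is `φ b - b' φ - d h`, the differential of the homotopy pullback. -/
theorem homD_pathEnd (t : (endPullback φ).carrier) :
    homD (pathObject φ).toDGModule (pathObject φ).toDGModule (pathEnd φ t) =
      pathEnd φ ((endPullback φ).d t) := by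
  refine LinearMap.ext fun x => ?_
  obtain ⟨⟨⟨b, hb⟩, ⟨b', hb'⟩⟩, ⟨h, hh⟩⟩ := t
  obtain ⟨⟨p, p'⟩, y⟩ := x
  refine (homD_apply _ _ _ _).trans ?_
  have s := DGComplex.homotopyPullback_sign_apply φ.toDGComplexHom
    (DGComplex.Hom.id P'.toDGComplex)
  refine (congrArg (fun a => (pathObject φ).d _ - a) ((s _).trans
    (congrArg (fun z => ((P.sign (pathEnd φ _ z).1.1, P'.sign (pathEnd φ _ z).1.2),
      - P'.sign (pathEnd φ _ z).2)) (s _)))).trans ?_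
  refine Prod.ext (Prod.ext rfl rfl) ?_
  change (φ.toK (b p) - b' p' - P'.d (h p + P'.sign (b' (P'.sign y)))) -
    - P'.sign (h (P.sign (P.d p)) + P'.sign (b' (P'.sign (- P'.sign (φ.toK p - p' - P'.d y))))) =
    (φ.toK (b p) - b' (φ.toK p) - (homD P P' h p)) +
      P'.sign (homD P' P' b' (P'.sign y))
  simp only [homD_apply, map_add, map_sub, map_neg, DGComplex.sign_sign, DGComplex.sign_d]
  abel

theorem pathEnd_mem_homDeg {i : ℤ} {t : (endPullback φ).carrier}
    (ht : t ∈ (endPullback φ).grading i) :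
    pathEnd φ t ∈ homDeg (pathObject φ).toDGModule (pathObject φ).toDGModule i := by
  refine DGComplex.mem_homDeg_toDGModule fun j x hx => ?_
  refine ⟨⟨ht.1.1.1 j _ hx.1.1, ht.1.2.1 j _ hx.1.2⟩, ?_⟩
  have h1 := ht.2.1 j _ hx.1.1
  have h2 := (signConj_mem_homDeg ht.1.2).1 _ _ hx.2
  rw [show i + -1 + j = i + j + -1 by ring] at h1
  rw [← add_assoc] at h2
  exact add_mem h1 h2

/-- The product on `endPullback φ` which corresponds to composition under `pathEnd φ`. -/
noncomputable def endPullbackMul (s t : (endPullback φ).carrier) : (endPullback φ).carrier :=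
  ((⟨s.1.1.1 ∘ₗ t.1.1.1, comp_mem_homTotal s.1.1.2 t.1.1.2⟩,
    ⟨s.1.2.1 ∘ₗ t.1.2.1, comp_mem_homTotal s.1.2.2 t.1.2.2⟩),
    ⟨s.2.1 ∘ₗ t.1.1.1 + signConj P' P' s.1.2.1 ∘ₗ t.2.1,
      add_mem (comp_mem_homTotal s.2.2 t.1.1.2)
        (comp_mem_homTotal (signConj_mem s.1.2.2) t.2.2)⟩)

theorem endPullbackMul_mem {i j : ℤ} {s t : (endPullback φ).carrier}
    (hs : s ∈ (endPullback φ).grading i) (ht : t ∈ (endPullback φ).grading j) :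
    endPullbackMul φ s t ∈ (endPullback φ).grading (i + j) := by
  refine ⟨⟨comp_mem_homDeg hs.1.1 ht.1.1, comp_mem_homDeg hs.1.2 ht.1.2⟩, ?_⟩
  have h1 := comp_mem_homDeg hs.2 ht.1.1
  have h2 := comp_mem_homDeg (signConj_mem_homDeg hs.1.2) ht.2
  rw [show i + -1 + j = i + j + -1 by ring] at h1
  rw [← add_assoc] at h2
  exact add_mem h1 h2

/-- This is multiplication of triangular matrices. Associativity and the Leibniz rule are then
inherited from composition of endomorphisms and need no check for `endPullbackMul`. -/
theorem pathEnd_mul (s t : (endPullback φ).carrier) :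
    pathEnd φ s * pathEnd φ t = pathEnd φ (endPullbackMul φ s t) := by
  refine LinearMap.ext fun x => Prod.ext rfl ?_
  change s.2.1 (t.1.1.1 x.1.1) +
      P'.sign (s.1.2.1 (P'.sign (t.2.1 x.1.1 + P'.sign (t.1.2.1 (P'.sign x.2))))) =
    s.2.1 (t.1.1.1 x.1.1) + P'.sign (s.1.2.1 (P'.sign (t.2.1 x.1.1))) +
      P'.sign (s.1.2.1 (t.1.2.1 (P'.sign x.2)))
  simp only [map_add, DGComplex.sign_sign]
  abel

/-- The unit for `endPullbackMul`. -/
noncomputable def endPullbackOne : (endPullback φ).carrier :=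
  ((⟨LinearMap.id, id_mem_homTotal⟩, ⟨LinearMap.id, id_mem_homTotal⟩), 0)

theorem endPullbackOne_mem : endPullbackOne φ ∈ (endPullback φ).grading 0 :=
  ⟨⟨one_mem_homDeg P, one_mem_homDeg P'⟩, zero_mem _⟩

theorem pathEnd_one : pathEnd φ (endPullbackOne φ) = 1 := by
  refine LinearMap.ext fun x => Prod.ext rfl ?_
  change (0 : P'.carrier) + P'.sign (P'.sign x.2) = x.2
  rw [zero_add, DGComplex.sign_sign]

/-- The algebra of endomorphisms `pathEnd φ t`. -/
noncomputable def pathSubalgebra :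
    Subalgebra K (Module.End K (pathObject φ).toDGModule.carrier) :=
  (LinearMap.range (pathEnd φ)).toSubalgebra ⟨_, pathEnd_one φ⟩ (by
    rintro _ _ ⟨s, rfl⟩ ⟨t, rfl⟩
    exact ⟨_, (pathEnd_mul φ s t).symm⟩)

theorem pathSubalgebra_toSubmodule : Subalgebra.toSubmodule (pathSubalgebra φ) =
    ⨆ i, ((endPullback φ).grading i).map (pathEnd φ) := by
  rw [← Submodule.map_iSup, (endPullback φ).isInternal.submodule_iSup_eq_top, Submodule.map_top]
  exact Submodule.toSubalgebra_toSubmodule _ _ _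

/-- The DG algebra of endomorphisms `pathEnd φ t`. -/
noncomputable def pathAlgebra : DGAlgebra.{u, w} K :=
  subEndAlgebra (pathObject φ).toDGModule (pathSubalgebra φ)
    (fun i => ((endPullback φ).grading i).map (pathEnd φ)) (pathSubalgebra_toSubmodule φ)
    (by rintro i _ ⟨t, ht, rfl⟩; exact pathEnd_mem_homDeg φ ht)
    ⟨_, endPullbackOne_mem φ, pathEnd_one φ⟩
    (by
      rintro i j _ ⟨s, hs, rfl⟩ _ ⟨t, ht, rfl⟩
      exact ⟨_, endPullbackMul_mem φ hs ht, (pathEnd_mul φ s t).symm⟩)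
    (by
      rintro i _ ⟨t, ht, rfl⟩
      exact ⟨_, (endPullback φ).d_mem i t ht, (homD_pathEnd φ t).symm⟩)

/-- The mapping path object as a DG module over `pathAlgebra φ`. -/
noncomputable def pathModule : DGModule.{u, w, w} (pathAlgebra φ) :=
  overSubEnd _ _ _ _ _ _ _ _

/-- The underlying DG `K`-module of `pathAlgebra φ` is `endPullback φ`. -/
noncomputable def pathEquiv : (endPullback φ).carrier ≃ₗ[K] (pathAlgebra φ).carrier :=
  LinearEquiv.ofInjective (pathEnd φ) (pathEnd_injective φ)

theorem pathEquiv_smul (t : (endPullback φ).carrier) (x : (pathModule φ).carrier) :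
    pathEquiv φ t • x = pathEnd φ t x := rfl

theorem pathEquiv_one : pathEquiv φ (endPullbackOne φ) = 1 :=
  Subtype.ext (pathEnd_one φ)

theorem pathEquiv_mul (s t : (endPullback φ).carrier) :
    pathEquiv φ s * pathEquiv φ t = pathEquiv φ (endPullbackMul φ s t) :=
  Subtype.ext (pathEnd_mul φ s t)

theorem pathEquiv_d (t : (endPullback φ).carrier) :
    (pathAlgebra φ).d (pathEquiv φ t) = pathEquiv φ ((endPullback φ).d t) :=
  Subtype.ext (homD_pathEnd φ t)

theorem pathEquiv_symm_mem {i : ℤ} {a : (pathAlgebra φ).carrier}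
    (ha : a ∈ (pathAlgebra φ).grading i) :
    (pathEquiv φ).symm a ∈ (endPullback φ).grading i := by
  obtain ⟨t, ht, e⟩ := ha
  obtain rfl : pathEquiv φ t = a := Subtype.ext e
  rwa [LinearEquiv.symm_apply_apply]

theorem pathEquiv_symm_one : (pathEquiv φ).symm 1 = endPullbackOne φ := by
  rw [← pathEquiv_one, LinearEquiv.symm_apply_apply]

theorem pathEquiv_symm_mul (a b : (pathAlgebra φ).carrier) : (pathEquiv φ).symm (a * b) =
    endPullbackMul φ ((pathEquiv φ).symm a) ((pathEquiv φ).symm b) := by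
  rw [LinearEquiv.symm_apply_eq, ← pathEquiv_mul, LinearEquiv.apply_symm_apply,
    LinearEquiv.apply_symm_apply]

theorem pathEquiv_symm_d (a : (pathAlgebra φ).carrier) : (pathEquiv φ).symm ((pathAlgebra φ).d a) =
    (endPullback φ).d ((pathEquiv φ).symm a) := by
  rw [LinearEquiv.symm_apply_eq, ← pathEquiv_d, LinearEquiv.apply_symm_apply]

/-- The projection `pathAlgebra φ → End_A(P)`. -/
noncomputable def pathAlgebraFst : DGAlgebra.Hom (pathAlgebra φ) P.endAlgebra where
  toAlgHom := AlgHom.ofLinearMap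
    ((LinearMap.fst K (homTotal P P) (homTotal P' P') ∘ₗ LinearMap.fst K _ (homTotal P P')) ∘ₗ
      (pathEquiv φ).symm.toLinearMap)
    (congrArg (fun t => t.1.1) (pathEquiv_symm_one φ))
    (fun a b => congrArg (fun t => t.1.1) (pathEquiv_symm_mul φ a b))
  map_mem _ _ ha := (pathEquiv_symm_mem φ ha).1.1
  map_d a := congrArg (fun t => t.1.1) (pathEquiv_symm_d φ a)

/-- The projection `pathAlgebra φ → End_A(P')`. -/
noncomputable def pathAlgebraSnd : DGAlgebra.Hom (pathAlgebra φ) P'.endAlgebra where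
  toAlgHom := AlgHom.ofLinearMap
    ((LinearMap.snd K (homTotal P P) (homTotal P' P') ∘ₗ LinearMap.fst K _ (homTotal P P')) ∘ₗ
      (pathEquiv φ).symm.toLinearMap)
    (congrArg (fun t => t.1.2) (pathEquiv_symm_one φ))
    (fun a b => congrArg (fun t => t.1.2) (pathEquiv_symm_mul φ a b))
  map_mem _ _ ha := (pathEquiv_symm_mem φ ha).1.2
  map_d a := congrArg (fun t => t.1.2) (pathEquiv_symm_d φ a)

theorem pathModule_smul (a : (pathAlgebra φ).carrier) (x : (pathModule φ).carrier) :
    a • x = pathEnd φ ((pathEquiv φ).symm a) x := by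
  rw [← pathEquiv_smul, LinearEquiv.apply_symm_apply]

/-- The projection of the mapping path object to `P`. -/
noncomputable def pathModuleFst :
    Hom (pathModule φ) (restrict (pathAlgebraFst φ) P.overEnd) where
  toFun x := x.1.1
  map_add' _ _ := rfl
  map_smul' a x := congrArg (fun z => z.1.1) (pathModule_smul φ a x)
  map_mem _ _ hx := hx.1.1
  map_d _ := rfl

/-- The projection of the mapping path object to `P'`. -/
noncomputable def pathModuleSnd :
    Hom (pathModule φ) (restrict (pathAlgebraSnd φ) P'.overEnd) where
  toFun x := x.1.2
  map_add' _ _ := rfl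
  map_smul' a x := congrArg (fun z => z.1.2) (pathModule_smul φ a x)
  map_mem _ _ hx := hx.1.2
  map_d _ := rfl

end DGModule

/-! ### The four projections. -/

theorem proposition1p3 {K : Type u} [CommRing K] (A : DGAlgebra.{u, v} K)
    (M P P' : DGModule.{u, v, w} A)
    (p : DGModule.Hom P M) (p' : DGModule.Hom P' M)
    (hP : P.IsKProjective) (hp : p.IsQuasiIso)
    (hP' : P'.IsKProjective) (hp' : p'.IsQuasiIso) :
    ∃ (B'' : DGAlgebra.{u, w} K) (P'' : DGModule.{u, w, w} B'')
      (f : DGAlgebra.Hom B'' P.endAlgebra) (f' : DGAlgebra.Hom B'' P'.endAlgebra)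
      (g : DGModule.Hom P'' (DGModule.restrict f P.overEnd))
      (g' : DGModule.Hom P'' (DGModule.restrict f' P'.overEnd)),
      f.IsQuasiIso ∧ f'.IsQuasiIso ∧ g.IsQuasiIso ∧ g'.IsQuasiIso := by
  obtain ⟨φ, hφ⟩ := hP.exists_isQuasiIso hp hp'
  refine ⟨DGModule.pathAlgebra φ, DGModule.pathModule φ, DGModule.pathAlgebraFst φ,
    DGModule.pathAlgebraSnd φ, DGModule.pathModuleFst φ, DGModule.pathModuleSnd φ, ?_, ?_, ?_, ?_⟩
  -- Each projection is a quasi-isomorphism because the opposite leg of its diagram is: `homPre` and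
  -- `homPost` for the algebra, the identity of `P'` and `φ` for the module.
  · exact DGComplex.Hom.IsQuasiIso.homotopyPullback_fst (W := (DGModule.pathAlgebra φ).toDGComplex)
      (DGModule.homPost P φ) (hP.homPre_isQuasiIso hP' hφ P') (DGModule.pathEquiv φ).symm
      (DGModule.pathEquiv_symm_d φ) (DGModule.pathAlgebraFst φ).toDGComplexHom (fun _ => rfl)
  · exact DGComplex.Hom.IsQuasiIso.homotopyPullback_snd (W := (DGModule.pathAlgebra φ).toDGComplex)
      (hP.homPost_isQuasiIso hφ) (DGModule.homPre φ P') (DGModule.pathEquiv φ).symm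
      (DGModule.pathEquiv_symm_d φ) (DGModule.pathAlgebraSnd φ).toDGComplexHom (fun _ => rfl)
  · exact DGComplex.Hom.IsQuasiIso.homotopyPullback_fst (W := DGModule.pathObject φ)
      φ.toDGComplexHom (DGComplex.Hom.id_isQuasiIso P'.toDGComplex) (LinearEquiv.refl K _)
      (fun _ => rfl) (DGModule.pathModuleFst φ).toDGComplexHom (fun _ => rfl)
  · exact DGComplex.Hom.IsQuasiIso.homotopyPullback_snd (W := DGModule.pathObject φ)
      (a := φ.toDGComplexHom) hφ (DGComplex.Hom.id P'.toDGComplex) (LinearEquiv.refl K _)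
      (fun _ => rfl) (DGModule.pathModuleSnd φ).toDGComplexHom (fun _ => rfl)
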